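/- Let $(T(t))_{t\ge 0}$ be a $C_0$-semigroup with generator $A$ on a complex Banach space $X$, and suppose that $\lambda\in\rho(A)$ for all $\lambda\in\mathbb{C}$ with $\operatorname{Re}\lambda>0$. Suppose that there is a non-decreasing function $g_0:(0,\infty)\to(0,\infty)$ such that the resolvent $R(\lambda,A)=(\lambda-A)^{-1}$ satisfies $\|R(\lambda,A)\|_{\mathcal L(X)}\le g_0\big(\tfrac{1}{\operatorname{Re}\lambda}\big)$ for all $\lambda\in\mathbb{C}$ with $\operatorname{Re}\lambda>0$. For $\alpha\ge 0$ let $(1-A)^\alpha$ be the fractional power of $1-A$, and let its domain $D((1-A)^\alpha)$ carry the norm $\|x\|_{D((1-A)^\alpha)}=\|x\|_X+\|(1-A)^\alpha x\|_X$. For Banach spaces $Y,Z$, exponents $p,q\in[1,\infty]$ and a strongly measurable $m:\mathbb{R}\to\mathcal{L}(Y,Z)$ of temperate growth, put $T_m f=\mathcal{F}^{-1}(m\cdot\mathcal{F}f)$ for Schwartz functions $f\in\mathcal{S}(\mathbb{R};Y)$, where $\mathcal{F}f(\xi)=\int_{\mathbb{R}}e^{-ix\xi}f(x)\,dx$. Write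 $m\in\mathcal{M}_{p,q}(Y,Z)$ if there is a $K\ge 0$ such that $\|T_mf\|_{L^q(\mathbb{R};Z)}\le K\|f\|_{L^p(\mathbb{R};Y)}$ for all $f\in\mathcal{S}(\mathbb{R};Y)$, and let $\|m\|_{\mathcal{M}_{p,q}(Y,Z)}$ be the least such $K$. Let $\alpha\ge 0$, and suppose that there exist a non-decreasing $g:(0,\infty)\to(0,\infty)$ and $p,q\in[1,\infty]$ such that, for all $\omega\in(0,1]$, one has $R(\omega+i\cdot,A)\in\mathcal{M}_{p,q}(D((1-A)^\alpha),X)$ and $$\|R(\omega+i\cdot,A)\|_{\mathcal{M}_{p,q}(D((1-A)^\alpha),X)}\le g\big(\tfrac1\omega\big).$$ Then there exists a $C\ge 0$ such that $$\|T(t)x\|_X\le C\,g(t)\,\|x\|_{D((1-A)^\alpha)}$$ for all $x\in D((1-A)^\alpha)$ and $t\ge 1$. -/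

import Mathlib

open Filter Topology MeasureTheory Set
open scoped NNReal ENNReal FourierTransform SchwartzMap

namespace SemigroupGrowth

/-- A `C₀`-semigroup of bounded operators on a complex normed space `X`. -/
structure C0Semigroup (X : Type*) [NormedAddCommGroup X] [NormedSpace ℂ X] where
  /-- the operators `T(t)`, `t ≥ 0` -/
  op : ℝ≥0 → X →L[ℂ] X
  op_zero : op 0 = ContinuousLinearMap.id ℂ X
  op_add : ∀ s t, op (s + t) = (op s).comp (op t)
  continuous_orbit : ∀ x, Continuous fun t => op t x

section Operators

variable {X : Type*} [NormedAddCommGroup X] [NormedSpace ℂ X]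

/-- The pairs `(x, y)` with `y = lim_{h ↓ 0} h⁻¹ (T(h) x - x)`. -/
def C0Semigroup.generatorGraph (T : C0Semigroup X) : Submodule ℂ (X × X) where
  carrier := {z | Tendsto (fun h : ℝ≥0 => (((h : ℝ) : ℂ))⁻¹ • (T.op h z.1 - z.1))
    (𝓝[>] 0) (𝓝 z.2)}
  zero_mem' := by simp
  add_mem' := by
    intro a b ha hb
    refine (ha.add hb).congr fun h => ?_
    simp only [Prod.fst_add, map_add, ← smul_add]
    congr 1
    abel
  smul_mem' := by
    intro c a ha
    refine (ha.const_smul c).congr fun h => ?_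
    simp only [Prod.smul_fst, map_smul, ← smul_sub]
    exact smul_comm _ _ _

theorem C0Semigroup.generatorGraph_functional (T : C0Semigroup X) (z : X × X)
    (hz : z ∈ T.generatorGraph) (h0 : z.1 = 0) : z.2 = 0 := by
  have hz' : Tendsto (fun h : ℝ≥0 => (((h : ℝ) : ℂ))⁻¹ • (T.op h z.1 - z.1))
    (𝓝[>] 0) (𝓝 z.2) := hz
  simp only [h0, map_zero, sub_zero, smul_zero] at hz'
  exact tendsto_nhds_unique hz' tendsto_const_nhds

/-- The generator `A` of a `C₀`-semigroup, as an unbounded operator: its domain consists of those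
`x` for which `A x := lim_{h ↓ 0} h⁻¹ (T(h) x - x)` exists. -/
noncomputable def C0Semigroup.generator (T : C0Semigroup X) : X →ₗ.[ℂ] X :=
  T.generatorGraph.toLinearPMap

theorem C0Semigroup.mem_generator_graph (T : C0Semigroup X) (x y : X) :
    (x, y) ∈ T.generator.graph ↔
      Tendsto (fun h : ℝ≥0 => (((h : ℝ) : ℂ))⁻¹ • (T.op h x - x)) (𝓝[>] 0) (𝓝 y) := by
  rw [C0Semigroup.generator, Submodule.toLinearPMap_graph_eq _ T.generatorGraph_functional]
  rfl

/-- `R` is a bounded two-sided inverse of `l - A : D(A) → X`. -/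
def IsResolventAt (A : X →ₗ.[ℂ] X) (l : ℂ) (R : X →L[ℂ] X) : Prop :=
  (∀ x : X, ∃ h : R x ∈ A.domain, l • R x - A ⟨R x, h⟩ = x) ∧
    ∀ x : A.domain, R (l • (x : X) - A x) = x

/-- The resolvent set `ρ(A)` of an unbounded operator `A`. -/
def opResolventSet (A : X →ₗ.[ℂ] X) : Set ℂ := {l | ∃ R, IsResolventAt A l R}

open Classical in
/-- The resolvent operator `R(l, A) = (l - A)⁻¹` for `l ∈ ρ(A)` (and `0` otherwise). -/
noncomputable def opResolvent (A : X →ₗ.[ℂ] X) (l : ℂ) : X →L[ℂ] X :=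
  if h : l ∈ opResolventSet A then h.choose else 0

/-- The operator `1 - A`, with domain `D(A)`. -/
noncomputable def oneSub (A : X →ₗ.[ℂ] X) : X →ₗ.[ℂ] X :=
  (LinearMap.id : X →ₗ[ℂ] X) +ᵥ (-A)

/-- The negative fractional power `B⁻ᵃ`, `a ≥ 0`, of an operator `B` with `(-∞, 0] ⊆ ρ(B)` and
`sup_{s > 0} (1 + s) ‖(s + B)⁻¹‖ < ∞`, through the Balakrishnan–Komatsu formula
`B⁻ᵃ = Γ(n) / (Γ(a) Γ(n - a)) ∫₀^∞ s^(n - a - 1) (s + B)⁻ⁿ ds`, with `n = ⌊a⌋ + 1`, for `a > 0`,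
and `B⁰ = I`. Note that `(s + B)⁻¹ = -R(-s, B)`. -/
noncomputable def negFracPow (B : X →ₗ.[ℂ] X) (a : ℝ) : X →L[ℂ] X :=
  if a = 0 then ContinuousLinearMap.id ℂ X
  else
    (((Real.Gamma (⌊a⌋₊ + 1 : ℝ) /
        (Real.Gamma a * Real.Gamma ((⌊a⌋₊ + 1 : ℝ) - a)) : ℝ)) : ℂ) •
      ∫ s in Ioi (0 : ℝ), ((s ^ ((⌊a⌋₊ + 1 : ℝ) - a - 1) : ℝ) : ℂ) •
        (-opResolvent B (-(s : ℂ))) ^ (⌊a⌋₊ + 1)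

/-- The fractional power `Bᵃ`, `a ≥ 0`: the inverse of the (injective) operator `B⁻ᵃ`, with domain
the range of `B⁻ᵃ`. -/
noncomputable def fracPow (B : X →ₗ.[ℂ] X) (a : ℝ) : X →ₗ.[ℂ] X :=
  ((negFracPow B a : X →ₗ[ℂ] X).toPMap ⊤).inverse

/-- The domain `D(B)` of an unbounded operator `B`, as a space of its own, which carries the graph
norm. -/
def GraphDomain (B : X →ₗ.[ℂ] X) : Type _ := B.domain

namespace GraphDomain

variable (B : X →ₗ.[ℂ] X)

instance : AddCommGroup (GraphDomain B) := inferInstanceAs (AddCommGroup B.domain)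

instance : Module ℂ (GraphDomain B) := inferInstanceAs (Module ℂ B.domain)

/-- The embedding of `D(B)` in `X`, as a linear map. -/
def toX : GraphDomain B →ₗ[ℂ] X := B.domain.subtype

/-- The operator `B` as a linear map on `D(B)`. -/
def apply : GraphDomain B →ₗ[ℂ] X := B.toFun

/-- The graph norm `‖x‖ + ‖B x‖`. -/
def graphNorm : AddGroupNorm (GraphDomain B) where
  toFun x := ‖toX B x‖ + ‖apply B x‖
  map_zero' := by simp
  add_le' x y := by
    rw [map_add, map_add]
    linarith [norm_add_le (toX B x) (toX B y), norm_add_le (apply B x) (apply B y)]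
  neg' x := by rw [map_neg, map_neg, norm_neg, norm_neg]
  eq_zero_of_map_eq_zero' x h := by
    have h1 : ‖toX B x‖ = 0 := by
      have h2 := norm_nonneg (toX B x)
      have h3 := norm_nonneg (apply B x)
      linarith
    exact Subtype.ext (norm_eq_zero.mp h1)

instance : NormedAddCommGroup (GraphDomain B) := (graphNorm B).toNormedAddCommGroup

theorem norm_def (x : GraphDomain B) : ‖x‖ = ‖toX B x‖ + ‖apply B x‖ := rfl

instance : NormedSpace ℂ (GraphDomain B) where
  norm_smul_le c x := by
    rw [norm_def, norm_def, map_smul, map_smul, norm_smul, norm_smul, mul_add]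

/-- The bounded embedding of `D(B)` in `X`. -/
noncomputable def incl : GraphDomain B →L[ℂ] X :=
  (toX B).mkContinuous 1 fun x => by
    rw [norm_def, one_mul]
    linarith [norm_nonneg (apply B x)]

/-- The domain of a closed operator on a Banach space is complete in the graph norm. -/
theorem completeSpace [CompleteSpace X] (hB : B.IsClosed) : CompleteSpace (GraphDomain B) := by
  have key : ∀ x y : GraphDomain B,
      dist x y = dist (toX B x) (toX B y) + dist (apply B x) (apply B y) := by
    intro x y
    rw [dist_eq_norm, norm_def, map_sub, map_sub, dist_eq_norm, dist_eq_norm]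
  refine Metric.complete_of_cauchySeq_tendsto fun u hu => ?_
  have h1 : CauchySeq fun n => toX B (u n) := by
    rw [Metric.cauchySeq_iff] at hu ⊢
    intro ε hε
    obtain ⟨N, hN⟩ := hu ε hε
    exact ⟨N, fun m hm n hn => lt_of_le_of_lt
      (by rw [key]; linarith [dist_nonneg (x := apply B (u m)) (y := apply B (u n))])
      (hN m hm n hn)⟩
  have h2 : CauchySeq fun n => apply B (u n) := by
    rw [Metric.cauchySeq_iff] at hu ⊢
    intro ε hε
    obtain ⟨N, hN⟩ := hu ε hε
    exact ⟨N, fun m hm n hn => lt_of_le_of_lt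
      (by rw [key]; linarith [dist_nonneg (x := toX B (u m)) (y := toX B (u n))])
      (hN m hm n hn)⟩
  obtain ⟨x, hx⟩ := cauchySeq_tendsto_of_complete h1
  obtain ⟨y, hy⟩ := cauchySeq_tendsto_of_complete h2
  have hxy : (x, y) ∈ B.graph := by
    have hcl : _root_.IsClosed (B.graph : Set (X × X)) := hB
    exact hcl.mem_of_tendsto (hx.prodMk_nhds hy)
      (Eventually.of_forall fun n => B.mem_graph (u n))
  obtain ⟨z, hz1, hz2⟩ := (LinearPMap.mem_graph_iff B).mp hxy
  let z' : GraphDomain B := z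
  refine ⟨z', ?_⟩
  rw [tendsto_iff_dist_tendsto_zero] at hx hy ⊢
  have hs := hx.add hy
  rw [add_zero] at hs
  refine hs.congr fun n => ?_
  rw [key]
  have e1 : toX B z' = x := hz1
  have e2 : apply B z' = y := hz2
  rw [e1, e2]

end GraphDomain

end Operators

section Multipliers

variable {X Y : Type*} [NormedAddCommGroup X] [NormedSpace ℂ X]
  [NormedAddCommGroup Y] [NormedSpace ℂ Y]

/-- The Fourier multiplier operator `T_m f = F⁻¹ (m · F f)` with symbol `m : ℝ → L(X, Y)`, where
`F f(ξ) = ∫ e^(-i x ξ) f(x) dx`. In terms of Mathlib's transform `𝓕 f(η) = ∫ e^(-2 π i x η) f(x) dx`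
one has `F f(2 π η) = 𝓕 f(η)`, so that
`T_m f(t) = (2 π)⁻¹ ∫ e^(i t ξ) m(ξ) F f(ξ) dξ = ∫ e^(2 π i t η) m(2 π η) 𝓕 f(η) dη`. -/
noncomputable def fourierMultiplier (m : ℝ → X →L[ℂ] Y) (f : 𝓢(ℝ, X)) : ℝ → Y :=
  𝓕⁻ (fun η : ℝ => m (2 * Real.pi * η) (𝓕 (f : ℝ → X) η))

/-- The constants `C ≥ 0` with `‖T_m f‖_{L^q(ℝ; Y)} ≤ C ‖f‖_{L^p(ℝ; X)}` for all Schwartz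
functions `f`. -/
def multiplierBounds (p q : ℝ≥0∞) (m : ℝ → X →L[ℂ] Y) : Set ℝ :=
  {C | 0 ≤ C ∧ ∀ f : 𝓢(ℝ, X),
    eLpNorm (fourierMultiplier m f) q volume ≤ ENNReal.ofReal C * eLpNorm (f : ℝ → X) p volume}

/-- `m` is a bounded `(L^p(ℝ; X), L^q(ℝ; Y))` Fourier multiplier, `m ∈ M_{p,q}(X, Y)`. The first
condition makes `F⁻¹ (m · F f)` meaningful as an absolutely convergent integral; it holds for every
strongly measurable symbol of temperate growth. -/
def IsFourierMultiplier (p q : ℝ≥0∞) (m : ℝ → X →L[ℂ] Y) : Prop :=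
  (∀ f : 𝓢(ℝ, X), Integrable (fun η : ℝ => m (2 * Real.pi * η) (𝓕 (f : ℝ → X) η)) volume) ∧
    (multiplierBounds p q m).Nonempty

/-- The multiplier norm `‖m‖_{M_{p,q}(X, Y)}`, the norm of `T_m` from `L^p(ℝ; X)` to
`L^q(ℝ; Y)`. -/
noncomputable def multiplierNorm (p q : ℝ≥0∞) (m : ℝ → X →L[ℂ] Y) : ℝ :=
  sInf (multiplierBounds p q m)

end Multipliers

/-- The symbol `ξ ↦ R(w + i ξ, A)`, with values in `L(D(B), X)`. -/
noncomputable def resolventSymbol {X : Type*} [NormedAddCommGroup X] [NormedSpace ℂ X]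
    (A B : X →ₗ.[ℂ] X) (w : ℝ) : ℝ → GraphDomain B →L[ℂ] X :=
  fun ξ => (opResolvent A ((w : ℂ) + Complex.I * (ξ : ℂ))).comp (GraphDomain.incl B)

end SemigroupGrowth

/-! Let `J₀` be the power $(1-A)^{-\alpha}$, let $x=J_0z$, and let $\psi$ be a smooth ramp, $0$
before time $1$ and $1$ after time $2$. Formally $v(s)=e^{-ws}\psi(s)T(s)x$ solves $v'=(A-w)v+f$
with $f(s)=e^{-ws}\psi'(s)T(s)x$, so $v=T_mf$ for $m=R(w+i\cdot,A)$. The input $f$ lives on $[1,2]$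
and its norm in the domain is at most a constant times that of $x$; the output is the damped orbit
on $[2,\infty)$. Take $w=1/t$. On $[t-1,t]$ the damping costs at most a factor $e$, and
$\|T(t)x\|\le M\|T(s)x\|$ there, so the multiplier bound at $w$ controls $T(t)x$ by $g(t)$. Both
time windows have length one, so $p$ and $q$ do not enter the constant. Times in $[1,3]$ are covered
by local boundedness of the semigroup.

Two points need care. The orbit could outgrow $e^{ws}$, so $v$ need not have a Fourier transform.
`fourierMultiplier_ramp` therefore switches $v$ off again after a time $r$; the error is the
multiplier applied to a function living to the right of $r$, and it vanishes at $r$ by causality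
(`fourierInv_symbol_eq_zero`), a contour argument resting on the bound by `g₀`. Orbits are mollified
to make $f$ Schwartz, and `norm_le_of_norm_smoothOrbit_le` removes the mollifier.

Second, the domain of the fractional power has to be a Banach space parametrised by `J₀`, which
rests on injectivity of `J₀`. Up to a constant, $J_0x$ is the value at $\tau=0$ of $F(\tau)=\int
s^{p-1}(s+\tau+B)^{-n}x\,ds$ with $B=1-A$, and $F'=-(n-p)(\tau+B)^{-1}F$ (`smul_integral_succ`). If
$F(0)=0$, then $F=0$ on $[0,\infty)$, whereas for large $\tau$ and $x\in D(A)$ the integral is close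
to a positive multiple of $x$ (`eq_zero_of_integral_eq_zero`). -/

namespace SemigroupGrowth

/-! ### Resolvents of unbounded operators, through graphs. -/

section Resolvent

variable {X : Type*} [NormedAddCommGroup X] [NormedSpace ℂ X] {A : X →ₗ.[ℂ] X} {l m : ℂ}
  {R S : X →L[ℂ] X}

theorem IsResolventAt.mem_graph (h : IsResolventAt A l R) (x : X) :
    (R x, l • R x - x) ∈ A.graph := by
  obtain ⟨hx, hx'⟩ := h.1 x
  rw [LinearPMap.mem_graph_iff]
  refine ⟨⟨R x, hx⟩, rfl, ?_⟩
  rw [eq_sub_iff_add_eq, ← eq_sub_iff_add_eq', hx']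

theorem IsResolventAt.apply_of_mem_graph (h : IsResolventAt A l R) {x y : X}
    (hxy : (x, y) ∈ A.graph) : R (l • x - y) = x := by
  obtain ⟨z, rfl, rfl⟩ := (LinearPMap.mem_graph_iff A).mp hxy
  exact h.2 z

theorem IsResolventAt.unique (h : IsResolventAt A l R) (h' : IsResolventAt A l S) : R = S := by
  ext x
  have := h'.apply_of_mem_graph (h.mem_graph x)
  rwa [sub_sub_cancel, eq_comm] at this

/-- The resolvent identity. -/
theorem IsResolventAt.sub_apply (h : IsResolventAt A l R) (h' : IsResolventAt A m S) (x : X) :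
    R x - S x = (m - l) • R (S x) := by
  have := h.apply_of_mem_graph (h'.mem_graph x)
  rw [map_sub, map_sub, map_smul, map_smul] at this
  rw [sub_smul, ← sub_eq_zero, ← sub_eq_zero.mpr this]
  abel

theorem IsResolventAt.injective (h : IsResolventAt A l R) {x : X} (hx : R x = 0) : x = 0 := by
  obtain ⟨hd, hx'⟩ := h.1 x
  have h2 : (⟨R x, hd⟩ : A.domain) = 0 := Subtype.ext hx
  rw [← hx', h2, LinearPMap.map_zero, hx, smul_zero, sub_zero]

theorem isResolventAt_opResolvent (h : l ∈ opResolventSet A) :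
    IsResolventAt A l (opResolvent A l) := by
  rw [opResolvent, dif_pos h]
  exact h.choose_spec

theorem IsResolventAt.opResolvent_eq (h : IsResolventAt A l R) : opResolvent A l = R :=
  (isResolventAt_opResolvent ⟨R, h⟩).unique h

theorem mem_oneSub_graph {x y : X} : (x, y) ∈ (oneSub A).graph ↔ (x, x - y) ∈ A.graph := by
  simp only [LinearPMap.mem_graph_iff]
  constructor
  · rintro ⟨⟨z, hz⟩, rfl, rfl⟩
    refine ⟨⟨z, hz⟩, rfl, ?_⟩
    simp only [oneSub, LinearPMap.vadd_apply, LinearMap.id_apply, LinearPMap.neg_apply]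
    abel_nf
  · rintro ⟨⟨z, hz⟩, rfl, h⟩
    refine ⟨⟨z, hz⟩, rfl, ?_⟩
    simp only [oneSub, LinearPMap.vadd_apply, LinearMap.id_apply, LinearPMap.neg_apply]
    change z + -A ⟨z, hz⟩ = y
    rw [h]
    abel

theorem isResolventAt_of_graph (h₁ : ∀ x, (R x, l • R x - x) ∈ A.graph)
    (h₂ : ∀ x y, (x, y) ∈ A.graph → R (l • x - y) = x) : IsResolventAt A l R := by
  refine ⟨fun x => ?_, fun x => h₂ _ _ (A.mem_graph x)⟩
  obtain ⟨z, hz, hz'⟩ := (LinearPMap.mem_graph_iff A).mp (h₁ x)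
  have hz : (z : X) = R x := hz
  have hz' : A z = l • R x - x := hz'
  have hd : R x ∈ A.domain := hz ▸ z.2
  refine ⟨hd, ?_⟩
  have : (⟨R x, hd⟩ : A.domain) = z := Subtype.ext hz.symm
  rw [this, hz', sub_sub_cancel]

/-- `(s + (1 - A))⁻¹ = R(1 + s, A)`. -/
theorem neg_opResolvent_oneSub {s : ℂ} (h : 1 + s ∈ opResolventSet A) :
    -opResolvent (oneSub A) (-s) = opResolvent A (1 + s) := by
  have hr := isResolventAt_opResolvent h
  rw [neg_eq_iff_eq_neg]
  refine IsResolventAt.opResolvent_eq (isResolventAt_of_graph (fun x => ?_) fun x y hxy => ?_)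
  · rw [mem_oneSub_graph]
    have := A.graph.neg_mem (hr.mem_graph x)
    convert! this using 1
    refine Prod.ext rfl ?_
    simp only [_root_.neg_apply, Prod.snd_neg, add_smul, one_smul, smul_neg, neg_smul]
    abel
  · have := hr.apply_of_mem_graph (mem_oneSub_graph.mp hxy)
    rw [_root_.neg_apply, ← map_neg]
    convert this using 2
    rw [add_smul, one_smul, neg_smul]
    abel

end Resolvent

/-! ### Orbits of the semigroup and a truncated Laplace transform. -/

section Orbit

variable {X : Type*} [NormedAddCommGroup X] [NormedSpace ℂ X] (T : C0Semigroup X) {l : ℂ}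
  {R : X →L[ℂ] X}

theorem C0Semigroup.op_mem_graph {x y : X} (h : (x, y) ∈ T.generator.graph) (s : ℝ≥0) :
    (T.op s x, T.op s y) ∈ T.generator.graph := by
  rw [T.mem_generator_graph] at h ⊢
  refine (((T.op s).continuous.tendsto y).comp h).congr fun r => ?_
  have : T.op s (T.op r x) = T.op r (T.op s x) := by
    rw [← ContinuousLinearMap.comp_apply, ← ContinuousLinearMap.comp_apply, ← T.op_add,
      ← T.op_add, add_comm]
  simp [this]

theorem C0Semigroup.op_resolvent (h : IsResolventAt T.generator l R) (s : ℝ≥0) (x : X) :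
    T.op s (R x) = R (T.op s x) := by
  have := h.apply_of_mem_graph (T.op_mem_graph (h.mem_graph x) s)
  rw [← this]
  congr 1
  rw [map_sub, map_smul, sub_sub_cancel]

/-- The orbit of `x`, extended to the negative half line by the constant `x`. -/
noncomputable def C0Semigroup.orbit (x : X) (s : ℝ) : X := T.op s.toNNReal x

theorem C0Semigroup.continuous_orbit' (x : X) : Continuous (T.orbit x) :=
  (T.continuous_orbit x).comp continuous_real_toNNReal

theorem C0Semigroup.orbit_add (x : X) {r s : ℝ} (hr : 0 ≤ r) (hs : 0 ≤ s) :
    T.orbit x (r + s) = T.op r.toNNReal (T.orbit x s) := by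
  rw [orbit, Real.toNNReal_add hr hs, T.op_add]
  rfl

theorem C0Semigroup.tendsto_slope_of_mem_graph {x y : X} (h : (x, y) ∈ T.generator.graph) :
    Tendsto (fun r : ℝ => r⁻¹ • (T.op r.toNNReal x - x)) (𝓝[>] 0) (𝓝 y) := by
  rw [T.mem_generator_graph] at h
  have hr : Tendsto Real.toNNReal (𝓝[>] 0) (𝓝[>] 0) := by
    refine tendsto_nhdsWithin_iff.mpr ⟨?_, ?_⟩
    · have := (continuous_real_toNNReal.tendsto 0).mono_left (nhdsWithin_le_nhds (s := Ioi 0))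
      rwa [Real.toNNReal_zero] at this
    · filter_upwards [self_mem_nhdsWithin] with r hr
      exact Real.toNNReal_pos.mpr hr
  refine (h.comp hr).congr' ?_
  filter_upwards [self_mem_nhdsWithin] with r hr
  simp only [Function.comp_apply]
  rw [Real.coe_toNNReal r (le_of_lt hr), ← Complex.ofReal_inv, Complex.coe_smul]

/-- For $r>s$ the increment factors as $T(s)(T(r-s)x-x)$, so the limit at $0$ defining the generator
is transported by $T(s)$. The right derivative is all that is used later. -/
theorem C0Semigroup.hasDerivWithinAt_orbit {x y : X} (h : (x, y) ∈ T.generator.graph) {s : ℝ}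
    (hs : 0 ≤ s) : HasDerivWithinAt (T.orbit x) (T.orbit y s) (Ioi s) s := by
  rw [hasDerivWithinAt_iff_tendsto_slope' (by simp)]
  have h1 : Tendsto (fun r : ℝ => r - s) (𝓝[>] s) (𝓝[>] 0) := by
    refine tendsto_nhdsWithin_iff.mpr ⟨?_, ?_⟩
    · have : Continuous fun r : ℝ => r - s := by fun_prop
      have := (this.tendsto s).mono_left (nhdsWithin_le_nhds (s := Ioi s))
      rwa [sub_self] at this
    · filter_upwards [self_mem_nhdsWithin] with r hr
      exact sub_pos.mpr (mem_Ioi.mp hr)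
  refine (((T.op s.toNNReal).continuous.tendsto y).comp
    ((T.tendsto_slope_of_mem_graph h).comp h1)).congr' ?_
  filter_upwards [self_mem_nhdsWithin] with r hr
  have hr' : 0 ≤ r - s := (sub_pos.mpr (mem_Ioi.mp hr)).le
  have := T.orbit_add x hs hr'
  simp only [Function.comp_apply, slope, vsub_eq_sub]
  rw [← add_sub_cancel s r, this, add_sub_cancel, ← Complex.coe_smul, map_smul, map_sub,
    Complex.coe_smul]
  rfl

theorem C0Semigroup.exists_bound [CompleteSpace X] (b : ℝ) :
    ∃ M : ℝ, 0 < M ∧ ∀ t : ℝ≥0, (t : ℝ) ≤ b → ‖T.op t‖ ≤ M := by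
  obtain ⟨C, hC⟩ := banach_steinhaus (g := fun t : {t : ℝ≥0 // t ≤ b.toNNReal} => T.op t) (by
    intro x
    have hK : IsCompact (Icc 0 b.toNNReal) := isCompact_Icc
    obtain ⟨C, hC⟩ := hK.exists_bound_of_continuousOn (T.continuous_orbit x).continuousOn
    exact ⟨C, fun t => hC t ⟨zero_le, t.2⟩⟩)
  refine ⟨|C| + 1, by positivity, fun t ht => ?_⟩
  have ht' : t ≤ b.toNNReal := NNReal.coe_le_coe.mp (ht.trans (Real.le_coe_toNNReal b))
  exact (hC ⟨t, ht'⟩).trans (by linarith [le_abs_self C])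

/-- Truncated Laplace transform of an orbit. -/
theorem C0Semigroup.resolvent_sub_eq_integral [CompleteSpace X] {l : ℝ}
    (h : IsResolventAt T.generator (l : ℂ) R) (x : X) :
    R x - Real.exp (-l) • R (T.op 1 x) =
      ∫ s in (0 : ℝ)..1, Real.exp (-(l * s)) • T.orbit x s := by
  set y := R x with hy
  have hg := h.mem_graph x
  have hcont : ContinuousOn (fun s => Real.exp (-(l * s)) • T.orbit y s) (Icc 0 1) :=
    ((by fun_prop : Continuous fun s : ℝ => Real.exp (-(l * s))).smul (T.continuous_orbit' y)).continuousOn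
  have hderiv : ∀ s ∈ Ioo (0 : ℝ) 1, HasDerivWithinAt (fun s => Real.exp (-(l * s)) • T.orbit y s)
      (-(Real.exp (-(l * s)) • T.orbit x s)) (Ioi s) s := by
    intro s hs
    have h1 : HasDerivAt (fun s => Real.exp (-(l * s))) (Real.exp (-(l * s)) * (-l)) s := by
      have := ((hasDerivAt_id s).const_mul l).neg.exp
      simpa using this
    have h2 := h1.hasDerivWithinAt.smul (s := Ioi s) (T.hasDerivWithinAt_orbit hg hs.1.le)
    convert! h2 using 1
    have : T.orbit (((l : ℝ) : ℂ) • y - x) s = l • T.orbit y s - T.orbit x s := by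
      rw [C0Semigroup.orbit, map_sub, map_smul, Complex.coe_smul]
      rfl
    rw [this, smul_sub, mul_neg, neg_smul, mul_smul]
    abel
  have hint : IntervalIntegrable (fun s => -(Real.exp (-(l * s)) • T.orbit x s)) volume 0 1 :=
    ((by fun_prop : Continuous fun s : ℝ => Real.exp (-(l * s))).smul (T.continuous_orbit' x)).neg.intervalIntegrable _ _
  have := intervalIntegral.integral_eq_sub_of_hasDeriv_right_of_le zero_le_one hcont hderiv hint
  rw [intervalIntegral.integral_neg, neg_eq_iff_eq_neg] at this
  rw [this]
  simp only [C0Semigroup.orbit, mul_one, Real.toNNReal_one, mul_zero, neg_zero, Real.exp_zero,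
    Real.toNNReal_zero, one_smul, T.op_zero, neg_sub, hy, T.op_resolvent h,
    ContinuousLinearMap.id_apply]

end Orbit

/-! ### Holomorphy and real-axis decay of the resolvent on the right half plane. -/

section HalfPlane

theorem norm_opResolvent_le {X : Type*} [NormedAddCommGroup X] [NormedSpace ℂ X]
    {A : X →ₗ.[ℂ] X} {g₀ : ℝ → ℝ} (hg₀_mono : MonotoneOn g₀ (Set.Ioi 0))
    (hg₀ : ∀ l : ℂ, 0 < l.re → ‖opResolvent A l‖ ≤ g₀ (1 / l.re))
    {l : ℂ} {w : ℝ} (hw : 0 < w) (hl : w ≤ l.re) : ‖opResolvent A l‖ ≤ g₀ (1 / w) := by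
  have hl' := hw.trans_le hl
  refine (hg₀ l hl').trans (hg₀_mono ?_ ?_ ?_)
  · exact one_div_pos.mpr hl'
  · exact one_div_pos.mpr hw
  · exact one_div_le_one_div_of_le hw hl


variable {X : Type*} [NormedAddCommGroup X] [NormedSpace ℂ X] (T : C0Semigroup X)
  (hρ : ∀ l : ℂ, 0 < l.re → l ∈ opResolventSet T.generator)

include hρ

theorem isResolventAt_of_re_pos {l : ℂ} (hl : 0 < l.re) :
    IsResolventAt T.generator l (opResolvent T.generator l) :=
  isResolventAt_opResolvent (hρ l hl)

theorem opResolvent_sub {l m : ℂ} (hl : 0 < l.re) (hm : 0 < m.re) :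
    opResolvent T.generator l - opResolvent T.generator m =
      (m - l) • (opResolvent T.generator l * opResolvent T.generator m) := by
  ext x
  exact (isResolventAt_of_re_pos T hρ hl).sub_apply (isResolventAt_of_re_pos T hρ hm) x

theorem commute_opResolvent {l m : ℂ} (hl : 0 < l.re) (hm : 0 < m.re) :
    Commute (opResolvent T.generator l) (opResolvent T.generator m) := by
  rcases eq_or_ne l m with rfl | hne
  · exact Commute.refl _
  have h1 := opResolvent_sub T hρ hl hm
  rw [← neg_sub, opResolvent_sub T hρ hm hl, ← neg_smul, neg_sub] at h1
  exact (smul_right_injective (X →L[ℂ] X) (sub_ne_zero.mpr hne.symm) h1).symm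

variable {g₀ : ℝ → ℝ} (hg₀_mono : MonotoneOn g₀ (Set.Ioi 0))
  (hg₀ : ∀ l : ℂ, 0 < l.re → ‖opResolvent T.generator l‖ ≤ g₀ (1 / l.re))

include hg₀_mono hg₀

/-- Monotonicity of `g₀` bounds the resolvent uniformly on
$\operatorname{Re}\ge\operatorname{Re}(l)/2$. The resolvent identity then gives first continuity and
afterwards the limit of the slopes. -/
theorem hasDerivAt_opResolvent {l : ℂ} (hl : 0 < l.re) :
    HasDerivAt (opResolvent T.generator) (-(opResolvent T.generator l) ^ 2) l := by
  set Rs := opResolvent T.generator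
  have hev : ∀ᶠ m : ℂ in 𝓝 l, l.re / 2 < m.re :=
    Complex.continuous_re.continuousAt.eventually (lt_mem_nhds (by linarith))
  have hcont : Tendsto Rs (𝓝 l) (𝓝 (Rs l)) := by
    rw [tendsto_iff_norm_sub_tendsto_zero]
    have hz : Tendsto (fun m : ℂ => ‖l - m‖ * (g₀ (1 / (l.re / 2)) * g₀ (1 / (l.re / 2)))) (𝓝 l)
        (𝓝 0) := by
      have : Continuous fun m : ℂ => ‖l - m‖ * (g₀ (1 / (l.re / 2)) * g₀ (1 / (l.re / 2))) := by
        fun_prop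
      have := this.tendsto l
      simpa using this
    refine squeeze_zero' (Eventually.of_forall fun _ => norm_nonneg _) ?_ hz
    filter_upwards [hev] with m hm
    rw [opResolvent_sub T hρ (by linarith) hl, norm_smul]
    refine mul_le_mul_of_nonneg_left ((norm_mul_le _ _).trans ?_) (norm_nonneg _)
    have h1 := norm_opResolvent_le hg₀_mono hg₀ (half_pos hl) hm.le
    have h2 := norm_opResolvent_le hg₀_mono hg₀ (l := l) (half_pos hl) (by linarith)
    exact mul_le_mul h1 h2 (norm_nonneg _) ((norm_nonneg _).trans h1)
  rw [hasDerivAt_iff_tendsto_slope]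
  have h2 : Tendsto (fun m => -(Rs m * Rs l)) (𝓝[≠] l) (𝓝 (-(Rs l) ^ 2)) := by
    rw [sq]
    exact ((hcont.mono_left nhdsWithin_le_nhds).mul_const _).neg
  refine h2.congr' ?_
  filter_upwards [hev.filter_mono nhdsWithin_le_nhds, self_mem_nhdsWithin] with m hm hne
  have hne' : m - l ≠ 0 := sub_ne_zero.mpr hne
  rw [slope_def_module, opResolvent_sub T hρ (by linarith) hl, ← neg_sub m l, neg_smul, smul_neg,
    smul_smul, inv_mul_cancel₀ hne', one_smul]

/-- `‖R(l, A)‖ ≤ M / l` on the half line `l ≥ 1 / 2`. -/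
theorem exists_norm_opResolvent_le_div [CompleteSpace X] :
    ∃ M : ℝ, 0 < M ∧ ∀ l : ℝ, 1 / 2 ≤ l → ‖opResolvent T.generator (l : ℂ)‖ ≤ M / l := by
  obtain ⟨M, hM, hT⟩ := T.exists_bound 1
  -- For $l\ge b$ the term $e^{-l}R\,T(1)$ of the truncated Laplace formula has norm at most
  -- $\|R\|/2$ and can be absorbed; the integral over $[0,1]$ supplies $M/l$.
  obtain ⟨b, hb⟩ : ∃ b : ℝ, Real.exp (-b) * M ≤ 1 / 2 ∧ 1 ≤ b := by
    have : Tendsto (fun b : ℝ => Real.exp (-b) * M) atTop (𝓝 (0 * M)) :=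
      (Real.tendsto_exp_neg_atTop_nhds_zero).mul_const M
    rw [zero_mul] at this
    exact ((this.eventually (ge_mem_nhds (by norm_num : (0 : ℝ) < 1 / 2))).and
      (eventually_ge_atTop 1)).exists
  have hlarge : ∀ l : ℝ, b ≤ l → ‖opResolvent T.generator (l : ℂ)‖ ≤ 2 * M / l := by
    intro l hl
    have hl0 : 0 < l := by linarith
    have hr := isResolventAt_of_re_pos T hρ (l := (l : ℂ)) (by simpa using hl0)
    set R := opResolvent T.generator (l : ℂ)
    have hR : ‖R‖ ≤ ‖R‖ / 2 + M / l := by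
      refine R.opNorm_le_bound (by positivity) fun x => ?_
      have heq := T.resolvent_sub_eq_integral hr x
      rw [sub_eq_iff_eq_add'] at heq
      rw [heq, add_mul]
      refine (norm_add_le _ _).trans (add_le_add ?_ ?_)
      · rw [norm_smul, Real.norm_eq_abs, abs_of_pos (Real.exp_pos _)]
        have h1 : ‖R (T.op 1 x)‖ ≤ ‖R‖ * (M * ‖x‖) := by
          refine (R.le_opNorm _).trans (mul_le_mul_of_nonneg_left ?_ (norm_nonneg _))
          exact (T.op 1).le_of_opNorm_le (hT 1 (by simp)) x
        have h2 : Real.exp (-l) ≤ Real.exp (-b) := Real.exp_le_exp.mpr (by linarith)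
        calc Real.exp (-l) * ‖R (T.op 1 x)‖ ≤ Real.exp (-b) * (‖R‖ * (M * ‖x‖)) := by
              gcongr
          _ = (Real.exp (-b) * M) * (‖R‖ * ‖x‖) := by ring
          _ ≤ 1 / 2 * (‖R‖ * ‖x‖) := by gcongr; exact hb.1
          _ = ‖R‖ / 2 * ‖x‖ := by ring
      · have hexp : ∫ s in (0 : ℝ)..1, Real.exp (-(l * s)) * (M * ‖x‖) ≤ M / l * ‖x‖ := by
          have hI : ∫ s in (0 : ℝ)..1, Real.exp (-(l * s)) = (1 - Real.exp (-l)) / l := by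
            have hd : ∀ s ∈ uIcc (0 : ℝ) 1, HasDerivAt (fun s => -(Real.exp (-(l * s)) / l))
                (Real.exp (-(l * s))) s := by
              intro s _
              have := ((((hasDerivAt_id s).const_mul l).neg.exp).div_const l).neg
              convert! this using 1
              simp only [id, mul_one, Pi.neg_apply]
              field_simp
            rw [intervalIntegral.integral_eq_sub_of_hasDerivAt hd
              (Continuous.intervalIntegrable (by fun_prop) _ _)]
            simp
            ring
          rw [intervalIntegral.integral_mul_const, hI]
          have : (1 - Real.exp (-l)) / l ≤ 1 / l := by
            gcongr
            linarith [Real.exp_pos (-l)]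
          calc (1 - Real.exp (-l)) / l * (M * ‖x‖) ≤ 1 / l * (M * ‖x‖) := by gcongr
            _ = M / l * ‖x‖ := by ring
        refine le_trans ?_ hexp
        refine intervalIntegral.norm_integral_le_of_norm_le zero_le_one ?_
          (Continuous.intervalIntegrable (by fun_prop) _ _)
        refine Eventually.of_forall fun s hs => ?_
        rw [norm_smul, Real.norm_eq_abs, abs_of_pos (Real.exp_pos _)]
        refine mul_le_mul_of_nonneg_left ?_ (Real.exp_pos _).le
        refine (T.op _).le_of_opNorm_le (hT _ ?_) x
        rw [Real.coe_toNNReal _ hs.1.le]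
        exact hs.2
    have h2 : 2 * M / l = 2 * (M / l) := by ring
    linarith
  have hg1 : 0 ≤ g₀ (1 / (1 / 2)) := (norm_nonneg _).trans
    (norm_opResolvent_le hg₀_mono hg₀ (l := 1) (by norm_num) (by norm_num))
  -- On $[1/2,b]$ the half-plane bound is enough, since $b/l\ge1$ there.
  refine ⟨max (2 * M) (b * g₀ (1 / (1 / 2))), lt_max_of_lt_left (by positivity), fun l hl => ?_⟩
  have hl0 : 0 < l := by linarith
  rcases le_total b l with h | h
  · refine (hlarge l h).trans ?_
    gcongr
    exact le_max_left _ _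
  · refine (norm_opResolvent_le hg₀_mono hg₀ (w := 1 / 2) (by norm_num)
      (by simpa using hl)).trans ?_
    rw [le_div_iff₀ hl0, mul_comm]
    exact (mul_le_mul_of_nonneg_right h hg1).trans (le_max_right _ _)

end HalfPlane

end SemigroupGrowth

/-! ### Balakrishnan–Komatsu integrals for a sectorial family. -/

namespace SemigroupGrowth

/-- The condition $0<p$ gives integrability at $0$, and $p<n$ at infinity. This kernel dominates the
fractional-power integrals below. -/
theorem integrableOn_rpow_div_one_add_pow {p : ℝ} {n : ℕ} (hp : 0 < p) (hpn : p < n) :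
    IntegrableOn (fun s : ℝ => s ^ (p - 1) / (1 + s) ^ n) (Ioi 0) := by
  have hmeas : AEStronglyMeasurable (fun s : ℝ => s ^ (p - 1) / (1 + s) ^ n)
      (volume.restrict (Ioi 0)) := by
    refine ContinuousOn.aestronglyMeasurable (fun s hs => ?_) measurableSet_Ioi
    have hs' : (0 : ℝ) < s := hs
    refine ContinuousAt.continuousWithinAt (ContinuousAt.div ?_ (by fun_prop) (by positivity))
    exact Real.continuousAt_rpow_const _ _ (Or.inl hs'.ne')
  rw [← Ioc_union_Ioi_eq_Ioi zero_le_one]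
  refine IntegrableOn.union ?_ ?_
  · have h1 : IntegrableOn (fun s : ℝ => s ^ (p - 1)) (Ioc 0 1) :=
      (intervalIntegrable_iff_integrableOn_Ioc_of_le zero_le_one).mp
        (intervalIntegral.intervalIntegrable_rpow' (by linarith))
    refine h1.mono' (hmeas.mono_measure (Measure.restrict_mono Ioc_subset_Ioi_self le_rfl)) ?_
    refine (ae_restrict_mem measurableSet_Ioc).mono fun s hs => ?_
    have hs' := hs.1
    rw [Real.norm_eq_abs, abs_of_nonneg (by positivity)]
    exact div_le_self (by positivity) (one_le_pow₀ (by linarith))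
  · have h1 : IntegrableOn (fun s : ℝ => s ^ (p - 1 - n)) (Ioi 1) :=
      integrableOn_Ioi_rpow_of_lt (by linarith) zero_lt_one
    refine h1.mono'
      (hmeas.mono_measure (Measure.restrict_mono (Ioi_subset_Ioi zero_le_one) le_rfl)) ?_
    refine (ae_restrict_mem measurableSet_Ioi).mono fun s hs => ?_
    have hs' : (0 : ℝ) < s := zero_lt_one.trans hs
    rw [Real.norm_eq_abs, abs_of_nonneg (by positivity), Real.rpow_sub hs' _ (n : ℝ), Real.rpow_natCast]
    gcongr
    linarith

/-- A family of commuting operators with the properties of `s ↦ (s + B)⁻¹`, where `B` is a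
sectorial operator with `0 ∈ ρ(B)`. -/
structure IsSectorialFamily {X : Type*} [NormedAddCommGroup X] [NormedSpace ℂ X]
    (R : ℝ → X →L[ℂ] X) (M : ℝ) : Prop where
  hasDerivAt : ∀ s, -1 / 2 < s → HasDerivAt R (-(R s) ^ 2) s
  norm_le : ∀ s, -1 / 2 < s → ‖R s‖ ≤ M / (1 + s)
  sub_eq : ∀ s t, -1 / 2 < s → -1 / 2 < t → R s - R t = (t - s) • (R s * R t)

namespace IsSectorialFamily

variable {X : Type*} [NormedAddCommGroup X] [NormedSpace ℂ X] {R : ℝ → X →L[ℂ] X} {M : ℝ}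
  (h : IsSectorialFamily R M) {p : ℝ} {n : ℕ} {τ : ℝ}

include h

theorem hasDerivAt_pow (n : ℕ) {s : ℝ} (hs : -1 / 2 < s) :
    HasDerivAt (fun s => R s ^ n) (-((n : ℝ) • R s ^ (n + 1))) s := by
  induction n with
  | zero => simpa using hasDerivAt_const s (1 : X →L[ℂ] X)
  | succ n ih =>
    have := ih.mul (h.hasDerivAt s hs)
    have h2 : (fun s => R s ^ (n + 1)) = (fun s => R s ^ n) * R := by
      ext1 s
      simp [pow_succ]
    rw [h2]
    convert! this using 1
    rw [neg_mul, mul_neg, smul_mul_assoc, ← pow_succ, ← pow_add]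
    push_cast
    rw [add_smul, one_smul, neg_add]

theorem hasDerivAt_pow_apply (n : ℕ) (x : X) {s : ℝ} (hs : -1 / 2 < s) :
    HasDerivAt (fun s => (R s ^ n) x) (-((n : ℝ) • (R s ^ (n + 1)) x)) s :=
  ((ContinuousLinearMap.apply ℂ X x).restrictScalars ℝ).hasFDerivAt.comp_hasDerivAt s
    (h.hasDerivAt_pow n hs)

theorem continuousAt_pow_apply (n : ℕ) (x : X) {s : ℝ} (hs : -1 / 2 < s + τ) :
    ContinuousAt (fun s => (R (s + τ) ^ n) x) s :=
  ContinuousAt.comp (f := fun s : ℝ => s + τ) (g := fun s => (R s ^ n) x)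
    (h.hasDerivAt_pow_apply n x hs).continuousAt (by fun_prop)

theorem nonneg : 0 ≤ M := by
  have := (norm_nonneg _).trans (h.norm_le 0 (by norm_num))
  simpa using this

theorem norm_pow_apply_le (n : ℕ) (x : X) {s : ℝ} (hs : -1 / 2 < s) :
    ‖(R s ^ n) x‖ ≤ M ^ n / (1 + s) ^ n * ‖x‖ := by
  rw [← div_pow]
  refine ((R s ^ n).le_opNorm x).trans (mul_le_mul_of_nonneg_right ?_ (norm_nonneg x))
  have := h.nonneg
  induction n with
  | zero =>
    rw [pow_zero, pow_zero]
    exact ContinuousLinearMap.norm_id_le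
  | succ n ih =>
    rw [pow_succ, pow_succ]
    exact (norm_mul_le _ _).trans
      (mul_le_mul ih (h.norm_le s hs) (norm_nonneg _) (pow_nonneg (div_nonneg this (by linarith)) _))

theorem aestronglyMeasurable (q : ℝ) (n : ℕ) (x : X) (hτ : -1 / 2 < τ) :
    AEStronglyMeasurable (fun s : ℝ => s ^ q • (R (s + τ) ^ n) x) (volume.restrict (Ioi 0)) := by
  refine ContinuousOn.aestronglyMeasurable (fun s hs => ?_) measurableSet_Ioi
  have hs' : (0 : ℝ) < s := hs
  have h1 : ContinuousAt (fun s : ℝ => s ^ q) s :=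
    Real.continuousAt_rpow_const _ _ (Or.inl hs'.ne')
  exact (h1.smul (h.continuousAt_pow_apply n x (s := s) (τ := τ) (by linarith))).continuousWithinAt

theorem norm_kernel_le (n : ℕ) (x : X) (hτ : -1 / 2 ≤ τ) {s q : ℝ} (hs : 0 < s) :
    ‖s ^ (q - 1) • (R (s + τ) ^ n) x‖ ≤ (2 * M) ^ n * ‖x‖ * (s ^ (q - 1) / (1 + s) ^ n) := by
  have hM := h.nonneg
  have h1 := h.norm_pow_apply_le n x (s := s + τ) (by linarith)
  have h2 : M ^ n / (1 + (s + τ)) ^ n ≤ M ^ n / ((1 + s) / 2) ^ n := by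
    gcongr
    linarith
  have h3 : M ^ n / ((1 + s) / 2) ^ n = (2 * M) ^ n / (1 + s) ^ n := by
    rw [div_pow, mul_pow]
    field_simp
  rw [norm_smul, Real.norm_eq_abs, abs_of_nonneg (by positivity)]
  calc s ^ (q - 1) * ‖(R (s + τ) ^ n) x‖
      ≤ s ^ (q - 1) * ((2 * M) ^ n / (1 + s) ^ n * ‖x‖) := by
        gcongr
        exact h1.trans (by rw [← h3]; gcongr)
    _ = _ := by ring

theorem integrableOn (x : X) (hτ : -1 / 2 < τ) {q : ℝ} (hq : 0 < q) (hqn : q < n) :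
    IntegrableOn (fun s : ℝ => s ^ (q - 1) • (R (s + τ) ^ n) x) (Ioi 0) := by
  refine ((integrableOn_rpow_div_one_add_pow hq hqn).const_mul ((2 * M) ^ n * ‖x‖)).mono'
    (h.aestronglyMeasurable _ n x hτ) ?_
  exact (ae_restrict_mem measurableSet_Ioi).mono fun s hs => h.norm_kernel_le n x hτ.le hs

/-- Differentiation under the integral sign. The family is controlled down to $-1/2$, so a ball of
radius $1/4$ about any $\tau\ge0$ is admissible and the derivative at $\tau=0$ is two-sided. -/
theorem hasDerivAt_integral [CompleteSpace X] (x : X) (hτ : 0 ≤ τ) (hp : 0 < p) (hpn : p < n) :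
    HasDerivAt (fun τ => ∫ s in Ioi (0 : ℝ), s ^ (p - 1) • (R (s + τ) ^ n) x)
      (-((n : ℝ) • ∫ s in Ioi (0 : ℝ), s ^ (p - 1) • (R (s + τ) ^ (n + 1)) x)) τ := by
  have e : -((n : ℝ) • ∫ s in Ioi (0 : ℝ), s ^ (p - 1) • (R (s + τ) ^ (n + 1)) x) =
      ∫ s in Ioi (0 : ℝ), -((n : ℝ) • s ^ (p - 1) • (R (s + τ) ^ (n + 1)) x) := by
    rw [integral_neg, MeasureTheory.integral_smul]
  rw [e]
  have hball : ∀ σ ∈ Metric.ball τ (1 / 4), -1 / 2 < σ := fun σ hσ => by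
    rw [Metric.mem_ball, Real.dist_eq, abs_lt] at hσ
    linarith [hσ.1]
  have hpn' : p < (n + 1 : ℕ) := by push_cast; linarith
  refine (hasDerivAt_integral_of_dominated_loc_of_deriv_le
    (F := fun τ s => s ^ (p - 1) • (R (s + τ) ^ n) x)
    (F' := fun τ s => -((n : ℝ) • s ^ (p - 1) • (R (s + τ) ^ (n + 1)) x))
    (bound := fun s => n * ((2 * M) ^ (n + 1) * ‖x‖ * (s ^ (p - 1) / (1 + s) ^ (n + 1))))
    (Metric.ball_mem_nhds τ (by norm_num : (0 : ℝ) < 1 / 4)) ?_ ?_ ?_ ?_ ?_ ?_).2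
  · filter_upwards [Metric.ball_mem_nhds τ (by norm_num : (0 : ℝ) < 1 / 4)] with σ hσ
    exact h.aestronglyMeasurable _ n x (hball σ hσ)
  · exact h.integrableOn x (by linarith) hp hpn
  · exact ((h.aestronglyMeasurable _ (n + 1) x (by linarith)).const_smul _).neg
  · refine (ae_restrict_mem measurableSet_Ioi).mono fun s hs σ hσ => ?_
    rw [norm_neg, norm_smul, Real.norm_natCast]
    exact mul_le_mul_of_nonneg_left (h.norm_kernel_le _ x (hball σ hσ).le hs) (Nat.cast_nonneg n)
  · exact ((integrableOn_rpow_div_one_add_pow hp hpn').const_mul _).const_mul _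
  · refine (ae_restrict_mem measurableSet_Ioi).mono fun s hs σ hσ => ?_
    have hs' : (0 : ℝ) < s := hs
    have h1 := h.hasDerivAt_pow_apply n x (s := s + σ) (by linarith [hball σ hσ])
    have h2 := (h1.comp_const_add s σ).const_smul (s ^ (p - 1))
    convert! h2 using 1
    rw [smul_neg, smul_comm]

/-- The boundary term $s^pR(s+\tau)^nx$ vanishes at $0$ because $p>0$ and at infinity because $p<n$.
-/
theorem integral_by_parts [CompleteSpace X] (x : X) (hτ : 0 ≤ τ) (hp : 0 < p) (hpn : p < n) :
    p • ∫ s in Ioi (0 : ℝ), s ^ (p - 1) • (R (s + τ) ^ n) x =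
      (n : ℝ) • ∫ s in Ioi (0 : ℝ), s ^ (p + 1 - 1) • (R (s + τ) ^ (n + 1)) x := by
  have hM := h.nonneg
  have hi1 := h.integrableOn (n := n) (τ := τ) x (by linarith) hp hpn
  have hi2 := h.integrableOn (n := n + 1) (τ := τ) x (by linarith) (q := p + 1) (by linarith)
    (by push_cast; linarith)
  have hlim : Tendsto (fun s : ℝ => s ^ p • (R (s + τ) ^ n) x) atTop (𝓝 0) := by
    have hz : Tendsto (fun s : ℝ => (2 * M) ^ n * ‖x‖ * s ^ (p - n)) atTop (𝓝 0) := by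
      have := (tendsto_rpow_neg_atTop (sub_pos.mpr hpn)).const_mul ((2 * M) ^ n * ‖x‖)
      simpa using this
    refine squeeze_zero_norm' ?_ hz
    filter_upwards [eventually_gt_atTop 0] with s hs
    have := h.norm_kernel_le n x (τ := τ) (by linarith) (q := p + 1) hs
    rw [add_sub_cancel_right] at this
    refine this.trans ?_
    rw [Real.rpow_sub hs, Real.rpow_natCast]
    gcongr
    linarith
  have hd : ∀ s ∈ Ioi (0 : ℝ), HasDerivAt (fun s : ℝ => s ^ p • (R (s + τ) ^ n) x)
      (p • (s ^ (p - 1) • (R (s + τ) ^ n) x) -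
        (n : ℝ) • (s ^ (p + 1 - 1) • (R (s + τ) ^ (n + 1)) x)) s := by
    intro s hs
    have hs' : (0 : ℝ) < s := hs
    have h1 := (h.hasDerivAt_pow_apply n x (s := s + τ) (by linarith)).comp_add_const s τ
    have h2 := (Real.hasDerivAt_rpow_const (p := p) (Or.inl hs'.ne')).smul h1
    convert! h2 using 1
    rw [add_sub_cancel_right, smul_neg, smul_comm (s ^ p), mul_smul, neg_add_eq_sub]
  have hc : ContinuousWithinAt (fun s : ℝ => s ^ p • (R (s + τ) ^ n) x) (Ici 0) 0 := by
    have h1 : ContinuousAt (fun s : ℝ => s ^ p) 0 :=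
      Real.continuousAt_rpow_const _ _ (Or.inr hp.le)
    exact (h1.smul (h.continuousAt_pow_apply n x (s := 0) (τ := τ)
      (by linarith))).continuousWithinAt
  have := integral_Ioi_of_hasDerivAt_of_tendsto hc hd
    ((hi1.smul p).sub (hi2.smul (n : ℝ))) hlim
  rw [integral_sub (by exact hi1.smul p) (by exact hi2.smul (n : ℝ)),
    MeasureTheory.integral_smul, MeasureTheory.integral_smul,
    Real.zero_rpow hp.ne', zero_smul, sub_zero] at this
  exact sub_eq_zero.mp this

theorem commute {s t : ℝ} (hs : -1 / 2 < s) (ht : -1 / 2 < t) : Commute (R s) (R t) := by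
  rcases eq_or_ne s t with rfl | hne
  · exact Commute.refl _
  have h1 := h.sub_eq s t hs ht
  rw [← neg_sub, h.sub_eq t s ht hs, ← neg_smul, neg_sub] at h1
  exact (smul_right_injective (X →L[ℂ] X) (sub_ne_zero.mpr hne.symm) h1).symm

/-- `∫ s^(p-1) (s + τ + B)^(-n) ds` is a multiple of `(τ + B)^(p-n)`, and its derivative
in `τ` is found accordingly. -/
theorem smul_integral_succ [CompleteSpace X] (x : X) (hτ : 0 ≤ τ) (hp : 0 < p) (hpn : p < n) :
    (n : ℝ) • ∫ s in Ioi (0 : ℝ), s ^ (p - 1) • (R (s + τ) ^ (n + 1)) x =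
      (n - p) • R τ (∫ s in Ioi (0 : ℝ), s ^ (p - 1) • (R (s + τ) ^ n) x) := by
  have hi1 := h.integrableOn (n := n) (τ := τ) x (by linarith) hp hpn
  have hi2 := h.integrableOn (n := n + 1) (τ := τ) x (by linarith) (q := p + 1) (by linarith)
    (by push_cast; linarith)
  have hi3 := h.integrableOn (n := n + 1) (τ := τ) x (by linarith) hp (by push_cast; linarith)
  have hb := congrArg (R τ) (h.integral_by_parts x hτ hp hpn)
  have hre : ∀ (c : ℝ) (v : X), R τ (c • v) = c • R τ v := fun c v => by
    rw [← Complex.coe_smul, map_smul, Complex.coe_smul]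
  rw [hre, hre, ← ContinuousLinearMap.integral_comp_comm _ hi2] at hb
  -- The identity $R(\tau)-R(s+\tau)=s\,R(\tau)R(s+\tau)$ consumes one factor $s$ and one factor
  -- $R(s+\tau)$, which brings both integrals back to the weight $s^{p-1}$.
  have hkey : ∫ s in Ioi (0 : ℝ), R τ (s ^ (p + 1 - 1) • (R (s + τ) ^ (n + 1)) x) =
      R τ (∫ s in Ioi (0 : ℝ), s ^ (p - 1) • (R (s + τ) ^ n) x) -
        ∫ s in Ioi (0 : ℝ), s ^ (p - 1) • (R (s + τ) ^ (n + 1)) x := by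
    rw [← ContinuousLinearMap.integral_comp_comm _ hi1, ← integral_sub
      ((R τ).integrable_comp hi1) hi3]
    refine setIntegral_congr_fun measurableSet_Ioi fun s hs => ?_
    have hs' : (0 : ℝ) < s := hs
    have h1 := h.sub_eq τ (s + τ) (by linarith) (by linarith)
    rw [add_sub_cancel_right] at h1
    have h2 := congrArg (fun S : X →L[ℂ] X => S ((R (s + τ) ^ n) x)) h1
    simp only [_root_.sub_apply, _root_.smul_apply,
      mul_apply_eq_comp] at h2
    have h3 : ∀ v, (R (s + τ) ^ (n + 1)) v = R (s + τ) ((R (s + τ) ^ n) v) := fun v => by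
      rw [pow_succ']
      rfl
    simp only [hre, h3]
    rw [← smul_sub, h2, smul_smul, add_sub_cancel_right, ← Real.rpow_add_one hs'.ne',
      sub_add_cancel]
  rw [hkey, smul_sub] at hb
  rw [sub_smul, hb]
  abel

/-- As a function of the shift, the integral solves the linear equation $F'=-(n-p)R(\tau)F$ with
$\|R(\tau)\|\le M$, so Grönwall's inequality propagates the zero initial value. -/
theorem integral_eq_zero [CompleteSpace X] {x : X} (hp : 0 < p) (hpn : p < n)
    (hx : ∫ s in Ioi (0 : ℝ), s ^ (p - 1) • (R s ^ n) x = 0) (hτ : 0 ≤ τ) :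
    ∫ s in Ioi (0 : ℝ), s ^ (p - 1) • (R (s + τ) ^ n) x = 0 := by
  have hM := h.nonneg
  set f : ℝ → X := fun τ => ∫ s in Ioi (0 : ℝ), s ^ (p - 1) • (R (s + τ) ^ n) x
  have hd : ∀ σ, 0 ≤ σ → HasDerivAt f (-((n - p) • R σ (f σ))) σ := fun σ hσ => by
    rw [← h.smul_integral_succ x hσ hp hpn]
    exact h.hasDerivAt_integral x hσ hp hpn
  have hg := norm_le_gronwallBound_of_norm_deriv_right_le (f := f)
    (f' := fun σ => -((n - p) • R σ (f σ))) (δ := 0) (K := (n - p) * M) (ε := 0) (a := 0) (b := τ)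
    (fun σ hσ => (hd σ hσ.1).continuousAt.continuousWithinAt)
    (fun σ hσ => (hd σ hσ.1).hasDerivWithinAt)
    (by simp only [f, add_zero, hx, norm_zero, le_refl]) (fun σ hσ => by
      rw [norm_neg, norm_smul, Real.norm_eq_abs, abs_of_pos (sub_pos.mpr hpn), add_zero, mul_assoc]
      refine mul_le_mul_of_nonneg_left ?_ (sub_pos.mpr hpn).le
      refine (R σ).le_of_opNorm_le ((h.norm_le σ (by linarith [hσ.1])).trans ?_) _
      exact div_le_self hM (by linarith [hσ.1])) τ ⟨hτ, le_rfl⟩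
  rw [gronwallBound_ε0_δ0] at hg
  exact norm_le_zero_iff.mp hg

/-- The hypothesis `hy` expresses in resolvent form that $x$ lies in the domain, with $y$ in the
role of $Ax$. Each further factor $(1+s)R(s)$ multiplies the old error by at most $M$ and adds
$R(s)y=O(1/(1+s))$. -/
theorem pow_apply_sub_le {x y : X} (hy : ∀ s, 0 ≤ s → (1 + s) • R s x - x = R s y) (n : ℕ) {s : ℝ}
    (hs : 0 ≤ s) : ‖(1 + s) ^ n • (R s ^ n) x - x‖ ≤ (n * (M + 1) ^ n * ‖y‖) / (1 + s) := by
  have hM := h.nonneg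
  have hs1 : 0 < 1 + s := by linarith
  have hRs := h.norm_le s (by linarith)
  induction n with
  | zero => simp
  | succ n ih =>
    have e : (1 + s) ^ (n + 1) • (R s ^ (n + 1)) x - x =
        (1 + s) • R s ((1 + s) ^ n • (R s ^ n) x - x) + R s y := by
      rw [← hy s hs, map_sub, ← Complex.coe_smul ((1 + s) ^ n), map_smul, Complex.coe_smul,
        pow_succ', pow_succ', mul_smul, smul_sub]
      simp only [mul_apply_eq_comp]
      abel
    rw [e]
    have h1 : ‖(1 + s) • R s ((1 + s) ^ n • (R s ^ n) x - x)‖ ≤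
        M * ((n * (M + 1) ^ n * ‖y‖) / (1 + s)) := by
      rw [norm_smul, Real.norm_eq_abs, abs_of_pos hs1]
      calc (1 + s) * ‖R s ((1 + s) ^ n • (R s ^ n) x - x)‖
          ≤ (1 + s) * (M / (1 + s) * ((n * (M + 1) ^ n * ‖y‖) / (1 + s))) := by
            gcongr
            exact ((R s).le_of_opNorm_le hRs _).trans (by gcongr)
        _ = _ := by field_simp
    have h2 : ‖R s y‖ ≤ M / (1 + s) * ‖y‖ := (R s).le_of_opNorm_le hRs _
    refine (norm_add_le _ _).trans ((add_le_add h1 h2).trans ?_)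
    have h3 : (1 : ℝ) ≤ (M + 1) ^ n := one_le_pow₀ (by linarith)
    have h4 : M * ((n * (M + 1) ^ n * ‖y‖) / (1 + s)) + M / (1 + s) * ‖y‖ =
        (M * (n * (M + 1) ^ n + 1) * ‖y‖) / (1 + s) := by ring
    rw [h4]
    push_cast
    refine div_le_div_of_nonneg_right (mul_le_mul_of_nonneg_right ?_ (norm_nonneg y)) hs1.le
    calc M * (n * (M + 1) ^ n + 1) ≤ (M + 1) * (n * (M + 1) ^ n + (M + 1) ^ n) := by
          gcongr
          linarith
      _ = _ := by ring

/-- For a large shift $\tau$ the integrand is the positive scalar $s^{p-1}/(1+s+\tau)^n$ times a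
vector within $\|x\|/2$ of $x$. Its integral could then vanish only for $x=0$, yet
`integral_eq_zero` makes it vanish. -/
theorem eq_zero_of_integral_eq_zero [CompleteSpace X] {x y : X} (hp : 0 < p) (hpn : p < n)
    (hy : ∀ s, 0 ≤ s → (1 + s) • R s x - x = R s y)
    (hx : ∫ s in Ioi (0 : ℝ), s ^ (p - 1) • (R s ^ n) x = 0) : x = 0 := by
  have hM := h.nonneg
  by_contra hne
  have hx0 : 0 < ‖x‖ := norm_pos_iff.mpr hne
  set K := n * (M + 1) ^ n * ‖y‖ with hK
  have hK0 : 0 ≤ K := by positivity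
  -- With this shift the error $K/(1+s+\tau)$ from `pow_apply_sub_le` is at most $\|x\|/2$ for all
  -- $s>0$.
  set τ := 2 * K / ‖x‖ with hτ
  have hτ0 : 0 ≤ τ := by positivity
  have hk : IntegrableOn (fun s : ℝ => s ^ (p - 1) / (1 + (s + τ)) ^ n) (Ioi 0) := by
    refine (integrableOn_rpow_div_one_add_pow hp hpn).mono' ?_ ?_
    · refine ContinuousOn.aestronglyMeasurable (fun s hs => ?_) measurableSet_Ioi
      have hs' : (0 : ℝ) < s := hs
      refine ContinuousAt.continuousWithinAt (ContinuousAt.div ?_ (by fun_prop) (by positivity))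
      exact Real.continuousAt_rpow_const _ _ (Or.inl hs'.ne')
    · refine (ae_restrict_mem measurableSet_Ioi).mono fun s hs => ?_
      have hs' : (0 : ℝ) < s := hs
      rw [Real.norm_eq_abs, abs_of_nonneg (by positivity)]
      gcongr
      linarith
  have h0 := h.integral_eq_zero hp hpn hx hτ0
  have hi := h.integrableOn (n := n) (τ := τ) x (by linarith) hp hpn
  have hpt : ∀ s ∈ Ioi (0 : ℝ),
      ‖s ^ (p - 1) • (R (s + τ) ^ n) x - (s ^ (p - 1) / (1 + (s + τ)) ^ n) • x‖ ≤
        s ^ (p - 1) / (1 + (s + τ)) ^ n * (‖x‖ / 2) := by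
    intro s hs
    have hs' : (0 : ℝ) < s := hs
    have h1 := h.pow_apply_sub_le hy n (s := s + τ) (by linarith)
    have h2 : K / (1 + (s + τ)) ≤ ‖x‖ / 2 := by
      rw [div_le_iff₀ (by linarith)]
      have : τ * ‖x‖ = 2 * K := by rw [hτ]; field_simp
      nlinarith
    have e : s ^ (p - 1) • (R (s + τ) ^ n) x - (s ^ (p - 1) / (1 + (s + τ)) ^ n) • x =
        (s ^ (p - 1) / (1 + (s + τ)) ^ n) • ((1 + (s + τ)) ^ n • (R (s + τ) ^ n) x - x) := by
      rw [smul_sub, smul_smul, div_mul_cancel₀ _ (by positivity)]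
    rw [e, norm_smul, Real.norm_eq_abs, abs_of_nonneg (by positivity)]
    gcongr
    exact h1.trans h2
  have hle := norm_integral_le_of_norm_le (hk.mul_const (‖x‖ / 2))
    ((ae_restrict_mem measurableSet_Ioi).mono hpt)
  rw [integral_sub hi (hk.smul_const x), h0, zero_sub, norm_neg, integral_smul_const, norm_smul,
    integral_mul_const, Real.norm_eq_abs] at hle
  have hpos : 0 < ∫ s in Ioi (0 : ℝ), s ^ (p - 1) / (1 + (s + τ)) ^ n := by
    rw [setIntegral_pos_iff_support_of_nonneg_ae _ hk]
    · have : Ioi (0 : ℝ) ⊆ Function.support (fun s : ℝ => s ^ (p - 1) / (1 + (s + τ)) ^ n) := by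
        intro s hs
        have hs' : (0 : ℝ) < s := hs
        exact (div_pos (Real.rpow_pos_of_pos hs' _) (by positivity)).ne'
      rw [inter_eq_right.mpr this]
      simp
    · refine (ae_restrict_mem measurableSet_Ioi).mono fun s hs => ?_
      have hs' : (0 : ℝ) < s := hs
      simp only [Pi.zero_apply]
      positivity
  rw [abs_of_pos hpos] at hle
  nlinarith [mul_pos hpos hx0]

end IsSectorialFamily

end SemigroupGrowth

namespace SemigroupGrowth

/-! ### Injectivity and commutation of the negative powers of $1-A$. -/

section FractionalPower

variable {X : Type*} [NormedAddCommGroup X] [NormedSpace ℂ X] [CompleteSpace X]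
  {T : C0Semigroup X} {M : ℝ}

theorem exists_isSectorialFamily
    (hρ : ∀ l : ℂ, 0 < l.re → l ∈ opResolventSet T.generator)
    {g₀ : ℝ → ℝ} (hg₀_mono : MonotoneOn g₀ (Set.Ioi 0))
    (hg₀ : ∀ l : ℂ, 0 < l.re → ‖opResolvent T.generator l‖ ≤ g₀ (1 / l.re)) :
    ∃ M, IsSectorialFamily (fun s : ℝ => opResolvent T.generator ((1 + s : ℝ) : ℂ)) M := by
  obtain ⟨M, hM, hb⟩ := exists_norm_opResolvent_le_div T hρ hg₀_mono hg₀
  have hpos : ∀ s : ℝ, -1 / 2 < s → 0 < (((1 + s : ℝ) : ℂ)).re := fun s hs => by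
    rw [Complex.ofReal_re]
    linarith
  refine ⟨M, fun s hs => ?_, fun s hs => hb _ (by linarith), fun s t hs ht => ?_⟩
  · have h1 := hasDerivAt_opResolvent T hρ hg₀_mono hg₀ (hpos s hs)
    have h2 : HasDerivAt (fun s : ℝ => ((1 + s : ℝ) : ℂ)) 1 s := by
      have := ((hasDerivAt_id s).const_add 1).ofReal_comp
      simpa using this
    have h3 := HasDerivAt.scomp s h1 h2
    rw [one_smul] at h3
    exact h3
  · rw [opResolvent_sub T hρ (hpos s hs) (hpos t ht), ← Complex.coe_smul]
    congr 1
    push_cast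
    ring

variable (h : IsSectorialFamily (fun s : ℝ => opResolvent T.generator ((1 + s : ℝ) : ℂ)) M)
  (hρ : ∀ l : ℂ, 0 < l.re → l ∈ opResolventSet T.generator)

include h hρ

omit [CompleteSpace X] in
theorem negFracPow_apply {a : ℝ} (ha : 0 < a) (x : X) :
    negFracPow (oneSub T.generator) a x =
      (Real.Gamma (⌊a⌋₊ + 1 : ℝ) / (Real.Gamma a * Real.Gamma ((⌊a⌋₊ + 1 : ℝ) - a))) •
        ∫ s in Ioi (0 : ℝ), s ^ ((⌊a⌋₊ + 1 : ℝ) - a - 1) •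
          (opResolvent T.generator ((1 + s : ℝ) : ℂ) ^ (⌊a⌋₊ + 1)) x := by
  have hM := h.nonneg
  set p : ℝ := (⌊a⌋₊ + 1 : ℝ) - a with hp
  set n : ℕ := ⌊a⌋₊ + 1 with hn
  have hp0 : 0 < p := by
    have := Nat.lt_floor_add_one a
    linarith
  have hpn : p < n := by
    rw [hp, hn]
    push_cast
    linarith
  set R : ℝ → X →L[ℂ] X := fun s => opResolvent T.generator ((1 + s : ℝ) : ℂ) with hR
  have hcongr : ∀ s ∈ Ioi (0 : ℝ), ((s ^ (p - 1) : ℝ) : ℂ) •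
      (-opResolvent (oneSub T.generator) (-(s : ℂ))) ^ n = s ^ (p - 1) • R s ^ n := by
    intro s hs
    have hs' : (0 : ℝ) < s := hs
    have hre : 0 < (1 + (s : ℂ)).re := by
      rw [Complex.add_re, Complex.one_re, Complex.ofReal_re]
      linarith
    rw [neg_opResolvent_oneSub (hρ _ hre), Complex.coe_smul, hR]
    push_cast
    rfl
  have hint : IntegrableOn (fun s : ℝ => s ^ (p - 1) • R s ^ n) (Ioi 0) := by
    refine ((integrableOn_rpow_div_one_add_pow hp0 hpn).const_mul (M ^ n)).mono' ?_ ?_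
    · refine ContinuousOn.aestronglyMeasurable (fun s hs => ?_) measurableSet_Ioi
      have hs' : (0 : ℝ) < s := hs
      have h1 : ContinuousAt (fun s : ℝ => s ^ (p - 1)) s :=
        Real.continuousAt_rpow_const _ _ (Or.inl hs'.ne')
      have h2 : ContinuousAt (fun s : ℝ => R s ^ n) s :=
        (h.hasDerivAt_pow n (by linarith)).continuousAt
      exact (h1.smul h2).continuousWithinAt
    · refine (ae_restrict_mem measurableSet_Ioi).mono fun s hs => ?_
      have hs' : (0 : ℝ) < s := hs
      have h2 : ‖R s ^ n‖ ≤ M ^ n / (1 + s) ^ n :=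
        (R s ^ n).opNorm_le_bound (by positivity) fun x =>
          h.norm_pow_apply_le n x (by linarith)
      rw [norm_smul, Real.norm_eq_abs, abs_of_nonneg (by positivity)]
      calc s ^ (p - 1) * ‖R s ^ n‖ ≤ s ^ (p - 1) * (M ^ n / (1 + s) ^ n) := by gcongr
        _ = _ := by ring
  rw [negFracPow, if_neg ha.ne', setIntegral_congr_fun measurableSet_Ioi hcongr, Complex.coe_smul,
    _root_.smul_apply, ContinuousLinearMap.integral_apply hint]
  rfl

/-- The negative fractional power of `1 - A` is injective. -/
theorem negFracPow_eq_zero {a : ℝ} (ha : 0 ≤ a) {x : X}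
    (hx : negFracPow (oneSub T.generator) a x = 0) : x = 0 := by
  rcases ha.eq_or_lt with rfl | ha
  · simpa [negFracPow] using hx
  rw [negFracPow_apply h hρ ha] at hx
  set p : ℝ := (⌊a⌋₊ + 1 : ℝ) - a with hp
  set n : ℕ := ⌊a⌋₊ + 1 with hn
  have hp0 : 0 < p := by
    have := Nat.lt_floor_add_one a
    linarith
  have hpn : p < n := by
    rw [hp, hn]
    push_cast
    linarith
  have hc : Real.Gamma (⌊a⌋₊ + 1 : ℝ) / (Real.Gamma a * Real.Gamma p) ≠ 0 :=
    (div_pos (Real.Gamma_pos_of_pos (by positivity))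
      (mul_pos (Real.Gamma_pos_of_pos ha) (Real.Gamma_pos_of_pos hp0))).ne'
  have hI := (smul_eq_zero.mp hx).resolve_left hc
  set R : ℝ → X →L[ℂ] X := fun s => opResolvent T.generator ((1 + s : ℝ) : ℂ) with hR
  have hr : ∀ s, 0 ≤ s → IsResolventAt T.generator ((1 + s : ℝ) : ℂ) (R s) := fun s hs =>
    isResolventAt_of_re_pos T hρ (by rw [Complex.ofReal_re]; linarith)
  have hint := h.integrableOn (τ := 0) x (by norm_num) hp0 hpn
  simp only [add_zero] at hint
  -- The criterion needs a vector of $D(A)$, so it is applied to `R 0 x`, for which $A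
  -- R(0)x=R(0)x-x$. Since `R 0` commutes with the integrand, the vanishing of the integral passes
  -- from $x$ to `R 0 x`.
  refine (hr 0 le_rfl).injective (h.eq_zero_of_integral_eq_zero (y := R 0 x - x) hp0 hpn ?_ ?_)
  · intro s hs
    have := (hr s hs).apply_of_mem_graph ((hr 0 le_rfl).mem_graph x)
    rw [map_sub, map_smul, Complex.coe_smul, add_zero, Complex.ofReal_one, one_smul,
      sub_eq_iff_eq_add] at this
    rw [sub_eq_iff_eq_add, this, add_comm]
  · have := congrArg (R 0) hI
    rw [map_zero, ← ContinuousLinearMap.integral_comp_comm _ hint] at this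
    rw [← this]
    refine setIntegral_congr_fun measurableSet_Ioi fun s hs => ?_
    have hs' : (0 : ℝ) < s := hs
    have h1 : Commute (R 0) (R s ^ n) := (h.commute (by norm_num) (by linarith)).pow_right n
    have h2 := congrArg (fun S : X →L[ℂ] X => S x) h1.eq
    simp only [mul_apply_eq_comp] at h2
    simp only [← Complex.coe_smul, map_smul]
    rw [h2]

/-- Used for $S=T(t)$ and for $S$ a resolvent, so that the fractional power can be moved past both
the orbit and the symbol. -/
theorem negFracPow_comm {a : ℝ} (ha : 0 ≤ a) {S : X →L[ℂ] X}
    (hS : ∀ s : ℝ, 0 < s → Commute S (opResolvent T.generator ((1 + s : ℝ) : ℂ))) (x : X) :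
    negFracPow (oneSub T.generator) a (S x) = S (negFracPow (oneSub T.generator) a x) := by
  rcases ha.eq_or_lt with rfl | ha
  · simp [negFracPow]
  rw [negFracPow_apply h hρ ha, negFracPow_apply h hρ ha, ← Complex.coe_smul, ← Complex.coe_smul,
    map_smul]
  congr 1
  have hp0 : 0 < (⌊a⌋₊ + 1 : ℝ) - a := by
    have := Nat.lt_floor_add_one a
    linarith
  have hint := h.integrableOn (n := ⌊a⌋₊ + 1) (τ := 0) x (by norm_num) hp0
    (by push_cast; linarith)
  simp only [add_zero] at hint
  rw [← ContinuousLinearMap.integral_comp_comm _ hint]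
  refine setIntegral_congr_fun measurableSet_Ioi fun s hs => ?_
  have h2 := congrArg (fun S : X →L[ℂ] X => S x) ((hS s hs).pow_right (⌊a⌋₊ + 1)).eq
  simp only [mul_apply_eq_comp] at h2
  simp only [← Complex.coe_smul, map_smul]
  rw [h2]

end FractionalPower

/-! ### The domain of the fractional power as a Banach space. -/

section Domain

variable {X : Type*} [NormedAddCommGroup X] [NormedSpace ℂ X] (B : X →ₗ.[ℂ] X) (a : ℝ)

theorem negFracPow_mem_domain (z : X) : negFracPow B a z ∈ (fracPow B a).domain := by
  rw [fracPow, LinearPMap.inverse_domain]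
  exact ⟨⟨z, trivial⟩, rfl⟩

theorem exists_negFracPow_eq (x : GraphDomain (fracPow B a)) :
    ∃ z, GraphDomain.toX _ x = negFracPow B a z := by
  have hx : GraphDomain.toX _ x ∈ ((negFracPow B a : X →ₗ[ℂ] X).toPMap ⊤).inverse.domain :=
    Subtype.prop (p := (· ∈ (fracPow B a).domain)) x
  rw [LinearPMap.inverse_domain] at hx
  obtain ⟨z, hz⟩ := hx
  exact ⟨z, hz.symm⟩

variable {B a} (hinj : ∀ z, negFracPow B a z = 0 → z = 0)

include hinj

theorem ker_toPMap_negFracPow :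
    LinearMap.ker ((negFracPow B a : X →ₗ[ℂ] X).toPMap ⊤).toFun = ⊥ := by
  rw [LinearMap.ker_eq_bot']
  intro z hz
  exact Subtype.ext (hinj z hz)

/-- The inverse of an injective bounded operator is closed. Completeness of the domain follows, and
with it a Bochner integral for functions with values there. -/
theorem fracPow_isClosed : (fracPow B a).IsClosed := by
  rw [fracPow, LinearPMap.inverse_closed_iff (ker_toPMap_negFracPow hinj), LinearPMap.IsClosed]
  have : ((((negFracPow B a : X →ₗ[ℂ] X).toPMap ⊤).graph : Set (X × X))) =
      {z | negFracPow B a z.1 = z.2} := by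
    ext z
    rw [SetLike.mem_coe, LinearPMap.mem_graph_iff]
    constructor
    · rintro ⟨y, hy, hy'⟩
      rw [mem_ofPred_eq, ← hy, ← hy']
      rfl
    · intro hz
      exact ⟨⟨z.1, trivial⟩, rfl, hz⟩
  rw [this]
  exact isClosed_eq (by fun_prop) (by fun_prop)

theorem fracPow_negFracPow (z : X) :
    fracPow B a ⟨negFracPow B a z, negFracPow_mem_domain B a z⟩ = z :=
  LinearPMap.inverse_apply_eq (ker_toPMap_negFracPow hinj) (x := ⟨z, trivial⟩) rfl

/-- The negative fractional power, as a bounded operator from `X` onto the domain of the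
fractional power. -/
theorem exists_toDomain : ∃ J : X →L[ℂ] GraphDomain (fracPow B a),
    (∀ z, GraphDomain.toX _ (J z) = negFracPow B a z) ∧
      (∀ z, ‖J z‖ = ‖negFracPow B a z‖ + ‖z‖) ∧ Function.Surjective J := by
  let J₀ : X →ₗ[ℂ] GraphDomain (fracPow B a) :=
    (negFracPow B a : X →ₗ[ℂ] X).codRestrict _ (negFracPow_mem_domain B a)
  have hn : ∀ z, ‖J₀ z‖ = ‖negFracPow B a z‖ + ‖z‖ := fun z => by
    rw [GraphDomain.norm_def]
    congr 2
    exact fracPow_negFracPow hinj z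
  refine ⟨J₀.mkContinuous (‖negFracPow B a‖ + 1) fun z => ?_, fun z => rfl, hn, fun x => ?_⟩
  · rw [hn, add_mul, one_mul]
    gcongr
    exact (negFracPow B a).le_opNorm z
  · obtain ⟨z, hz⟩ := exists_negFracPow_eq B a x
    exact ⟨z, Subtype.ext hz.symm⟩

end Domain

end SemigroupGrowth

namespace SemigroupGrowth

/-! ### Integrals over vertical lines. -/

section Contour

theorem continuous_verticalLine {E : Type*} [TopologicalSpace E] {H : ℂ → E}
    (hH : ∀ l : ℂ, 0 < l.re → ContinuousAt H l) {w : ℝ}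
    (hw : 0 < w) : Continuous fun y : ℝ => H (w + y * Complex.I) := by
  refine continuous_iff_continuousAt.mpr fun y => ?_
  have h1 : ContinuousAt H (w + y * Complex.I) := hH _ (by simpa using hw)
  exact ContinuousAt.comp (f := fun y : ℝ => (w + y * Complex.I : ℂ)) h1 (by fun_prop)

variable {E : Type*} [NormedAddCommGroup E] [NormedSpace ℂ E]

/-- A holomorphic function on the right half plane with quadratic decay has vanishing integrals
over vertical lines. -/
theorem integral_verticalLine_eq_zero [CompleteSpace E] {H : ℂ → E}
    (hH : ∀ l : ℂ, 0 < l.re → DifferentiableAt ℂ H l) {w K : ℝ} (hw : 0 < w)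
    (hK : ∀ l : ℂ, w ≤ l.re → ‖H l‖ ≤ K / ‖l‖ ^ 2) :
    ∫ y : ℝ, H (w + y * Complex.I) = 0 := by
  by_cases hint : Integrable fun y : ℝ => H (w + y * Complex.I)
  swap
  · exact integral_undef hint
  have hK0 : 0 ≤ K := by
    have h1 := (norm_nonneg _).trans (hK w (by simp))
    by_contra hneg
    have h2 : K / ‖(w : ℂ)‖ ^ 2 < 0 := div_neg_of_neg_of_pos (not_le.mp hneg) (by simpa using pow_pos hw 2)
    linarith
  have hlim := intervalIntegral_tendsto_integral hint tendsto_neg_atTop_atBot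
    (tendsto_id (α := ℝ) (x := atTop))
  refine tendsto_nhds_unique hlim ?_
  have hz : Tendsto (fun N : ℝ => 4 * K / N) atTop (𝓝 0) := tendsto_const_nhds.div_atTop tendsto_id
  refine squeeze_zero_norm' ?_ hz
  filter_upwards [eventually_gt_atTop 0] with N hN
  -- The right side of the rectangle moves away with its height: the three sides other than the
  -- given line have length $O(N)$, and there the integrand is at most $K/N^2$.
  have hrect := Complex.integral_boundary_rect_eq_zero_of_differentiableOn H
    ((w : ℂ) + (-N : ℝ) * Complex.I) ((w + N : ℝ) + (N : ℝ) * Complex.I) (fun l hl => by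
      refine (hH l ?_).differentiableWithinAt
      have h1 := hl.1
      simp only [Complex.add_re, Complex.ofReal_re, Complex.mul_re, Complex.ofReal_im,
        Complex.I_re, Complex.I_im, mul_zero, zero_mul, sub_zero, add_zero, mem_preimage] at h1
      rw [uIcc_of_le (by linarith)] at h1
      linarith [h1.1])
  simp only [Complex.add_re, Complex.ofReal_re, Complex.mul_re, Complex.ofReal_im,
        Complex.I_re, Complex.I_im, mul_zero, sub_zero, add_zero, Complex.add_im,
        Complex.mul_im, mul_one, zero_add] at hrect
  have hbd : ∀ l : ℂ, w ≤ l.re → N ≤ ‖l‖ → ‖H l‖ ≤ K / N ^ 2 := fun l hl hl' =>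
    (hK l hl).trans (by gcongr)
  have hb : ‖∫ x : ℝ in w..(w + N), H (x + (-N : ℝ) * Complex.I)‖ ≤ K / N ^ 2 * |w + N - w| := by
    refine intervalIntegral.norm_integral_le_of_norm_le_const fun x hx => hbd _ ?_ ?_
    · rw [uIoc_of_le (by linarith)] at hx
      simpa using hx.1.le
    · refine le_trans ?_ (Complex.abs_im_le_norm _)
      simp [abs_of_pos hN]
  have ht : ‖∫ x : ℝ in w..(w + N), H (x + (N : ℝ) * Complex.I)‖ ≤ K / N ^ 2 * |w + N - w| := by
    refine intervalIntegral.norm_integral_le_of_norm_le_const fun x hx => hbd _ ?_ ?_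
    · rw [uIoc_of_le (by linarith)] at hx
      simpa using hx.1.le
    · refine le_trans ?_ (Complex.abs_im_le_norm _)
      simp [abs_of_pos hN]
  have hr : ‖∫ y : ℝ in (-N)..N, H ((w + N : ℝ) + y * Complex.I)‖ ≤ K / N ^ 2 * |N - -N| := by
    refine intervalIntegral.norm_integral_le_of_norm_le_const fun x hx => hbd _ ?_ ?_
    · simp [hN.le]
    · refine le_trans ?_ (Complex.abs_re_le_norm _)
      simp only [Complex.add_re, Complex.ofReal_re, Complex.mul_re, Complex.ofReal_im,
        Complex.I_re, Complex.I_im, mul_zero, mul_one, sub_zero, add_zero]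
      rw [abs_of_pos (by linarith)]
      linarith
  have e1 : |w + N - w| = N := by rw [add_sub_cancel_left, abs_of_pos hN]
  have e2 : |N - -N| = 2 * N := by rw [sub_neg_eq_add, abs_of_pos (by linarith)]; ring
  rw [e1] at hb ht
  rw [e2] at hr
  have hleft : ‖Complex.I • ∫ y : ℝ in (-N)..N, H (w + y * Complex.I)‖ ≤
      K / N ^ 2 * N + K / N ^ 2 * N + K / N ^ 2 * (2 * N) := by
    rw [← sub_eq_zero.mp hrect]
    refine (norm_add_le _ _).trans (add_le_add ((norm_sub_le _ _).trans (add_le_add hb ht)) ?_)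
    rw [norm_smul, Complex.norm_I, one_mul]
    exact hr
  rw [norm_smul, Complex.norm_I, one_mul] at hleft
  refine hleft.trans (le_of_eq ?_)
  field_simp
  ring

end Contour

/-! ### Laplace transforms of compactly supported functions, and causality. -/

section Laplace

variable {E : Type*} [NormedAddCommGroup E] [NormedSpace ℂ E]

/-- The two-sided Laplace transform. -/
noncomputable def laplace (k : ℝ → E) (l : ℂ) : E := ∫ s : ℝ, Complex.exp (-(l * s)) • k s

theorem integrable_exp_smul {k : ℝ → E} (hk : Continuous k) (hc : HasCompactSupport k) (l : ℂ) :
    Integrable fun s : ℝ => Complex.exp (-(l * s)) • k s :=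
  Continuous.integrable_of_hasCompactSupport (by fun_prop) hc.smul_left

theorem hasDerivAt_exp_mul (l : ℂ) (s : ℝ) :
    HasDerivAt (fun s : ℝ => Complex.exp (-(l * s))) (-(l * Complex.exp (-(l * s)))) s := by
  have := ((((hasDerivAt_id s).ofReal_comp).const_mul l).neg).cexp
  convert! this using 1
  simp
  ring

theorem laplace_deriv {k k' : ℝ → E} (hk : ∀ s, HasDerivAt k (k' s) s)
    (hk' : Continuous k') (hc : HasCompactSupport k) (hc' : HasCompactSupport k') (l : ℂ) :
    laplace k' l = l • laplace k l := by
  have hcont : Continuous k := continuous_iff_continuousAt.mpr fun s => (hk s).continuousAt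
  have hi := integrable_exp_smul hcont hc l
  have hi' := integrable_exp_smul hk' hc' l
  have hd : ∀ s : ℝ, HasDerivAt (fun s : ℝ => Complex.exp (-(l * s)) • k s)
      (Complex.exp (-(l * s)) • k' s - l • (Complex.exp (-(l * s)) • k s)) s := fun s => by
    have := (hasDerivAt_exp_mul l s).smul (hk s)
    convert! this using 1
    rw [neg_smul, mul_smul, sub_eq_add_neg]
  have := integral_eq_zero_of_hasDerivAt_of_integrable hd (hi'.sub (hi.smul l)) hi
  rw [integral_sub hi' (by exact hi.smul l), MeasureTheory.integral_smul, sub_eq_zero] at this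
  exact this

theorem norm_laplace_le {k : ℝ → E} (hk : Continuous k) (hc : HasCompactSupport k) {b : ℝ}
    (hb : ∀ s < b, k s = 0) {l : ℂ} (hl : 0 ≤ l.re) :
    ‖laplace k l‖ ≤ Real.exp (-(l.re * b)) * ∫ s, ‖k s‖ := by
  rw [← integral_const_mul]
  refine norm_integral_le_of_norm_le ((hk.norm.integrable_of_hasCompactSupport hc.norm).const_mul _)
    (Eventually.of_forall fun s => ?_)
  rcases lt_or_ge s b with h | h
  · simp [hb s h]
  · rw [norm_smul, Complex.norm_exp]
    gcongr
    simp only [Complex.neg_re, Complex.mul_re, Complex.ofReal_re, Complex.ofReal_im, mul_zero,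
      sub_zero]
    nlinarith

theorem differentiable_laplace {k : ℝ → E} (hk : Continuous k) (hc : HasCompactSupport k) :
    Differentiable ℂ (laplace k) := by
  intro l
  have hcont : ∀ m : ℂ, Continuous fun s : ℝ => Complex.exp (-(m * s)) • k s := fun m => by
    fun_prop
  have := hasDerivAt_integral_of_dominated_loc_of_deriv_le (μ := volume) (x₀ := l)
    (F := fun (m : ℂ) (s : ℝ) => Complex.exp (-(m * s)) • k s)
    (F' := fun (m : ℂ) (s : ℝ) => (-(s : ℂ) * Complex.exp (-(m * s))) • k s)
    (bound := fun s => (|s| * Real.exp ((‖l‖ + 1) * |s|)) * ‖k s‖)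
    (Metric.ball_mem_nhds l one_pos)
    (Eventually.of_forall fun m => (hcont m).aestronglyMeasurable)
    (integrable_exp_smul hk hc l) ?_ ?_ ?_ ?_
  · exact this.2.differentiableAt
  · exact Continuous.aestronglyMeasurable (by fun_prop)
  · refine Eventually.of_forall fun s m hm => ?_
    rw [norm_smul, norm_mul, norm_neg, Complex.norm_real, Real.norm_eq_abs, Complex.norm_exp]
    gcongr
    have hm' : ‖m‖ ≤ ‖l‖ + 1 := by
      rw [Metric.mem_ball, dist_eq_norm] at hm
      have := norm_le_norm_add_norm_sub' m l
      linarith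
    calc (-(m * s)).re ≤ ‖-(m * (s : ℂ))‖ := Complex.re_le_norm _
      _ = ‖m‖ * |s| := by rw [norm_neg, norm_mul, Complex.norm_real, Real.norm_eq_abs]
      _ ≤ _ := by gcongr
  · exact Continuous.integrable_of_hasCompactSupport (by fun_prop) hc.norm.mul_left
  · refine Eventually.of_forall fun s m _ => ?_
    have h1 : HasDerivAt (fun m : ℂ => Complex.exp (-(m * s))) (-(s : ℂ) * Complex.exp (-(m * s)))
        m := by
      have := (((hasDerivAt_id m).mul_const (s : ℂ)).neg).cexp
      convert! this using 1
      simp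
      ring
    exact h1.smul_const _

/-- The transform of a smooth function decays quadratically. -/
theorem exists_norm_laplace_le {k : ℝ → E} (hk : ContDiff ℝ 2 k) (hc : HasCompactSupport k)
    {b : ℝ} (hb : ∀ s < b, k s = 0) :
    ∃ K, 0 ≤ K ∧ ∀ l : ℂ, 0 < l.re → ‖laplace k l‖ ≤ K * Real.exp (-(l.re * b)) / ‖l‖ ^ 2 := by
  have h1 : ContDiff ℝ 1 (deriv k) := ((contDiff_succ_iff_deriv (n := 1)).mp hk).2.2
  have h2 : Continuous (deriv (deriv k)) := h1.continuous_deriv le_rfl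
  have hd1 : ∀ s, HasDerivAt k (deriv k s) s := fun s =>
    (hk.differentiable (by norm_num) s).hasDerivAt
  have hd2 : ∀ s, HasDerivAt (deriv k) (deriv (deriv k) s) s := fun s =>
    (h1.differentiable (by norm_num) s).hasDerivAt
  have hb1 : ∀ f : ℝ → E, (∀ s < b, f s = 0) → ∀ s < b, deriv f s = 0 := fun f hf s hs => by
    have : f =ᶠ[𝓝 s] fun _ => 0 := by
      filter_upwards [gt_mem_nhds hs] with r hr using hf r hr
    rw [this.deriv_eq, deriv_const]
  refine ⟨∫ s, ‖deriv (deriv k) s‖, integral_nonneg fun _ => norm_nonneg _, fun l hl => ?_⟩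
  have hl0 : 0 < ‖l‖ := norm_pos_iff.mpr fun h => by simp [h] at hl
  have e : laplace (deriv (deriv k)) l = l • l • laplace k l := by
    rw [laplace_deriv hd2 h2 hc.deriv hc.deriv.deriv, laplace_deriv hd1 h1.continuous hc hc.deriv]
  have h3 := norm_laplace_le h2 hc.deriv.deriv (hb1 _ (hb1 _ hb)) hl.le
  rw [e, norm_smul, norm_smul] at h3
  rw [le_div_iff₀ (by positivity)]
  calc ‖laplace k l‖ * ‖l‖ ^ 2 = ‖l‖ * (‖l‖ * ‖laplace k l‖) := by ring
    _ ≤ _ := h3.trans (le_of_eq (mul_comm _ _))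

theorem fourier_exp_smul (k : ℝ → E) (w η : ℝ) :
    𝓕 (fun s : ℝ => Complex.exp (-(w * s)) • k s) η =
      laplace k (w + Complex.I * ((2 * Real.pi * η : ℝ) : ℂ)) := by
  rw [Real.fourier_real_eq_integral_exp_smul, laplace]
  refine integral_congr_ae (Eventually.of_forall fun s => ?_)
  simp only
  rw [smul_smul, ← Complex.exp_add]
  congr 2
  push_cast
  ring

theorem fourierInv_real_eq (f : ℝ → E) (r : ℝ) :
    𝓕⁻ f r = ∫ η : ℝ, Complex.exp (Complex.I * ((2 * Real.pi * η : ℝ) : ℂ) * r) • f η := by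
  rw [Real.fourierInv_eq_fourier_neg, Real.fourier_real_eq_integral_exp_smul]
  refine integral_congr_ae (Eventually.of_forall fun s => ?_)
  simp only
  congr 2
  push_cast
  ring

/-- Causality: convolution with the inverse transform of a bounded holomorphic symbol does not
move supports to the left. -/
theorem fourierInv_symbol_eq_zero {F : Type*} [NormedAddCommGroup F] [NormedSpace ℂ F]
    [CompleteSpace F] {S : ℂ → E →L[ℂ] F} (hS : ∀ l : ℂ, 0 < l.re → DifferentiableAt ℂ S l)
    {w G : ℝ} (hw : 0 < w) (hG : ∀ l : ℂ, w ≤ l.re → ‖S l‖ ≤ G) {k : ℝ → E}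
    (hk : ContDiff ℝ 2 k) (hc : HasCompactSupport k) {b r : ℝ} (hb : ∀ s < b, k s = 0)
    (hr : r ≤ b) :
    𝓕⁻ (fun η : ℝ => S (w + Complex.I * ((2 * Real.pi * η : ℝ) : ℂ))
      (𝓕 (fun s : ℝ => Complex.exp (-(w * s)) • k s) η)) r = 0 := by
  obtain ⟨K, hK0, hK⟩ := exists_norm_laplace_le hk hc hb
  -- After the substitution $y=2\pi\eta$ the inverse transform is a constant times the integral of
  -- `H` over $\operatorname{Re}=w$. As $r\le b$, the exponentials combine to
  -- $e^{(r-b)\operatorname{Re}l}\le1$, leaving the quadratic decay of the transform.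
  set H : ℂ → F := fun l => Complex.exp (l * r) • S l (laplace k l) with hHdef
  have hG0 : 0 ≤ G := (norm_nonneg _).trans (hG w (by simp))
  have hH : ∀ l : ℂ, 0 < l.re → DifferentiableAt ℂ H l := fun l hl => by
    have h1 : DifferentiableAt ℂ (fun l => S l (laplace k l)) l :=
      (hS l hl).clm_apply (differentiable_laplace hk.continuous hc l)
    have h2 : DifferentiableAt ℂ (fun l : ℂ => Complex.exp (l * r)) l := by fun_prop
    exact h2.smul h1
  have hbound : ∀ l : ℂ, w ≤ l.re → ‖H l‖ ≤ (G * K) / ‖l‖ ^ 2 := fun l hl => by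
    have hl0 : 0 < l.re := hw.trans_le hl
    have hn : 0 < ‖l‖ := norm_pos_iff.mpr fun h => by simp [h] at hl0
    have h1 : ‖S l (laplace k l)‖ ≤ G * (K * Real.exp (-(l.re * b)) / ‖l‖ ^ 2) :=
      ((S l).le_of_opNorm_le (hG l hl) _).trans (by gcongr; exact hK l hl0)
    have h2 : ‖Complex.exp (l * r)‖ = Real.exp (l.re * r) := by
      rw [Complex.norm_exp]
      simp
    rw [hHdef, norm_smul, h2]
    calc Real.exp (l.re * r) * ‖S l (laplace k l)‖
        ≤ Real.exp (l.re * r) * (G * (K * Real.exp (-(l.re * b)) / ‖l‖ ^ 2)) := by gcongr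
      _ = Real.exp (l.re * r + -(l.re * b)) * ((G * K) / ‖l‖ ^ 2) := by rw [Real.exp_add]; ring
      _ ≤ 1 * ((G * K) / ‖l‖ ^ 2) := by
          gcongr
          rw [Real.exp_le_one_iff]
          nlinarith
      _ = _ := one_mul _
  have hzero := integral_verticalLine_eq_zero hH hw hbound
  rw [fourierInv_real_eq]
  have e : ∀ η : ℝ, Complex.exp (Complex.I * ((2 * Real.pi * η : ℝ) : ℂ) * r) •
      S (w + Complex.I * ((2 * Real.pi * η : ℝ) : ℂ))
        (𝓕 (fun s : ℝ => Complex.exp (-(w * s)) • k s) η) =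
      Complex.exp (-(w * r)) • H (w + ((2 * Real.pi * η : ℝ) : ℂ) * Complex.I) := fun η => by
    rw [fourier_exp_smul, hHdef]
    simp only
    rw [smul_smul, ← Complex.exp_add, mul_comm _ Complex.I]
    congr 2
    ring
  simp_rw [e]
  rw [MeasureTheory.integral_smul]
  have hcv := Measure.integral_comp_mul_left (fun y : ℝ => H (w + (y : ℂ) * Complex.I))
    (2 * Real.pi)
  rw [hzero, smul_zero] at hcv
  rw [hcv, smul_zero]

end Laplace

end SemigroupGrowth

namespace SemigroupGrowth

/-! ### Mollified orbits. -/

section SmoothOrbit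

open scoped Convolution ContDiff

variable {X : Type*} [NormedAddCommGroup X] [NormedSpace ℂ X] (T : C0Semigroup X)
  (φ : ContDiffBump (0 : ℝ))

/-- The convolution of a bump function and an orbit. -/
noncomputable def smoothOrbit (z : X) : ℝ → X :=
  φ.normed volume ⋆[ContinuousLinearMap.lsmul ℝ ℝ, volume] T.orbit z

theorem smoothOrbit_apply (z : X) (s : ℝ) :
    smoothOrbit T φ z s = ∫ r, φ.normed volume r • T.orbit z (s - r) := rfl

theorem contDiff_smoothOrbit (z : X) : ContDiff ℝ ∞ (smoothOrbit T φ z) :=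
  φ.hasCompactSupport_normed.contDiff_convolution_left _ φ.contDiff_normed
    (T.continuous_orbit' z).locallyIntegrable

theorem integrable_smoothOrbit (z : X) (s : ℝ) :
    Integrable fun r => φ.normed volume r • T.orbit z (s - r) := by
  have h1 : Continuous (φ.normed volume) := φ.continuous_normed
  have h2 : Continuous fun r => T.orbit z (s - r) := (T.continuous_orbit' z).comp (by fun_prop)
  exact (h1.smul h2).integrable_of_hasCompactSupport φ.hasCompactSupport_normed.smul_right

theorem normed_bump_eq_zero {r : ℝ} (hφ : φ.rOut ≤ 1) (hr : 1 ≤ |r|) :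
    φ.normed volume r = 0 := by
  have : r ∉ Function.support (φ.normed volume) := by
    rw [φ.support_normed_eq, Metric.mem_ball, dist_zero_right, Real.norm_eq_abs, not_lt]
    exact hφ.trans hr
  simpa using this

theorem map_smoothOrbit [CompleteSpace X] {S : X →L[ℂ] X} (hS : ∀ t z, S (T.op t z) = T.op t (S z))
    (z : X) (s : ℝ) : S (smoothOrbit T φ z s) = smoothOrbit T φ (S z) s := by
  rw [smoothOrbit_apply, smoothOrbit_apply,
    ← ContinuousLinearMap.integral_comp_comm _ (integrable_smoothOrbit T φ z s)]
  refine integral_congr_ae (Eventually.of_forall fun r => ?_)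
  simp only [← Complex.coe_smul, map_smul, C0Semigroup.orbit, hS]

/-- From time $1$ on, a mollifier of radius at most $1$ samples the orbit only at nonnegative times,
where the semigroup law holds. -/
theorem smoothOrbit_add [CompleteSpace X] (hφ : φ.rOut ≤ 1) (z : X) {s h : ℝ} (hs : 1 ≤ s)
    (hh : 0 ≤ h) : smoothOrbit T φ z (h + s) = T.op h.toNNReal (smoothOrbit T φ z s) := by
  rw [smoothOrbit_apply, smoothOrbit_apply,
    ← ContinuousLinearMap.integral_comp_comm _ (integrable_smoothOrbit T φ z s)]
  refine integral_congr_ae (Eventually.of_forall fun r => ?_)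
  simp only [← Complex.coe_smul, map_smul]
  rcases le_or_gt 1 |r| with hr | hr
  · simp [normed_bump_eq_zero φ hφ hr]
  · rw [add_sub_assoc, T.orbit_add z hh (by linarith [(abs_lt.mp hr).2])]

theorem norm_smoothOrbit_le (hφ : φ.rOut ≤ 1) (z : X) {M s : ℝ}
    (hM : ∀ t : ℝ≥0, (t : ℝ) ≤ 3 → ‖T.op t‖ ≤ M) (hs : 1 ≤ s) (hs' : s ≤ 2) :
    ‖smoothOrbit T φ z s‖ ≤ M * ‖z‖ := by
  have h1 : ∫ r, φ.normed volume r * (M * ‖z‖) = M * ‖z‖ := by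
    rw [integral_mul_const, φ.integral_normed, one_mul]
  rw [← h1, smoothOrbit_apply]
  refine norm_integral_le_of_norm_le (φ.integrable_normed.mul_const _)
    (Eventually.of_forall fun r => ?_)
  rcases le_or_gt 1 |r| with hr | hr
  · simp [normed_bump_eq_zero φ hφ hr]
  · rw [norm_smul, Real.norm_eq_abs, abs_of_nonneg (φ.nonneg_normed r)]
    refine mul_le_mul_of_nonneg_left ?_ (φ.nonneg_normed r)
    refine (T.op _).le_of_opNorm_le (hM _ ?_) z
    rw [abs_lt] at hr
    rw [Real.coe_toNNReal _ (by linarith)]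
    linarith

/-- The bound is uniform in the bump, so it survives the limit along bumps shrinking to a point. -/
theorem norm_le_of_norm_smoothOrbit_le [CompleteSpace X] (z : X) (t : ℝ) {C : ℝ}
    (hC : ∀ φ : ContDiffBump (0 : ℝ), φ.rOut ≤ 1 → ‖smoothOrbit T φ z t‖ ≤ C) :
    ‖T.orbit z t‖ ≤ C := by
  let ψ : ℕ → ContDiffBump (0 : ℝ) := fun n =>
    ⟨1 / ((n : ℝ) + 1) / 2, 1 / ((n : ℝ) + 1), by positivity, half_lt_self (by positivity)⟩
  have hlim := ContDiffBump.convolution_tendsto_right_of_continuous (φ := ψ) (μ := volume)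
    (g := T.orbit z) (tendsto_one_div_add_atTop_nhds_zero_nat) (T.continuous_orbit' z) t
  refine le_of_tendsto hlim.norm (Eventually.of_forall fun n => hC (ψ n) ?_)
  change 1 / ((n : ℝ) + 1) ≤ 1
  rw [div_le_one (by positivity)]
  linarith [n.cast_nonneg (α := ℝ)]

end SmoothOrbit

/-! ### The evolution equation in resolvent form. -/

section Identity

open scoped ContDiff

variable {X : Type*} [NormedAddCommGroup X] [NormedSpace ℂ X] (T : C0Semigroup X) {u : ℝ → X}

/-- This is $u'=Au$ with $R$ applied and $AR=lR-I$ inserted, so that $u(s)\in D(A)$ is never needed.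
The right derivative at $0$ of $h\mapsto R\,u(h+s)=T(h)R\,u(s)$ is computed in two ways. -/
theorem resolvent_deriv_of_orbit {l : ℂ} {R : X →L[ℂ] X} (hR : IsResolventAt T.generator l R)
    (hu : Differentiable ℝ u) {s : ℝ}
    (hTu : ∀ h : ℝ, 0 ≤ h → u (h + s) = T.op h.toNNReal (u s)) :
    R (deriv u s) = l • R (u s) - u s := by
  have h1 : HasDerivAt (fun h : ℝ => u (h + s)) (deriv u s) 0 :=
    HasDerivAt.comp_add_const 0 s (by rw [zero_add]; exact (hu s).hasDerivAt)
  have h2 : HasDerivWithinAt (fun h : ℝ => R (u (h + s))) (R (deriv u s)) (Ioi 0) 0 :=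
    ((R.restrictScalars ℝ).hasFDerivAt.comp_hasDerivAt 0 h1).hasDerivWithinAt
  have h3 := T.hasDerivWithinAt_orbit (hR.mem_graph (u s)) le_rfl
  have h4 : HasDerivWithinAt (fun h : ℝ => R (u (h + s))) (T.orbit (l • R (u s) - u s) 0)
      (Ioi 0) 0 := by
    refine h3.congr (fun h hh => ?_) ?_
    · rw [hTu h (le_of_lt hh), C0Semigroup.orbit, T.op_resolvent hR]
    · rw [hTu 0 le_rfl, C0Semigroup.orbit, T.op_resolvent hR]
  have h5 := (uniqueDiffWithinAt_Ioi (0 : ℝ)).eq_deriv _ h2 h4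
  rw [h5, C0Semigroup.orbit, Real.toNNReal_zero, T.op_zero, ContinuousLinearMap.id_apply]

theorem laplace_map {E F : Type*} [NormedAddCommGroup E] [NormedSpace ℂ E] [CompleteSpace E]
    [NormedAddCommGroup F] [NormedSpace ℂ F] [CompleteSpace F] (S : E →L[ℂ] F) {k : ℝ → E}
    (hk : Continuous k) (hc : HasCompactSupport k) (l : ℂ) :
    laplace (fun s => S (k s)) l = S (laplace k l) := by
  rw [laplace, laplace, ← ContinuousLinearMap.integral_comp_comm _ (integrable_exp_smul hk hc l)]
  simp only [map_smul]

/-- If `u' = A u` on the support of the cutoff `c`, then `(l - A) (c u)^ = (c' u)^`. -/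
theorem laplace_cutoff [CompleteSpace X] {l : ℂ} {R : X →L[ℂ] X}
    (hR : IsResolventAt T.generator l R)
    (hu : ContDiff ℝ ∞ u) (hTu : ∀ s h : ℝ, 1 ≤ s → 0 ≤ h → u (h + s) = T.op h.toNNReal (u s))
    {c : ℝ → ℝ} (hc : ContDiff ℝ ∞ c) (hcs : HasCompactSupport c) (hc0 : ∀ s ≤ 1, c s = 0) :
    laplace (fun s => c s • u s) l = R (laplace (fun s => deriv c s • u s) l) := by
  have hud : Differentiable ℝ u := hu.differentiable (by simp)
  have hcd : Differentiable ℝ c := hc.differentiable (by simp)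
  have hc' : Continuous (deriv c) := hc.continuous_deriv (by simp)
  have hre : ∀ (c : ℝ) (v : X), R (c • v) = c • R v := fun c v => by
    rw [← Complex.coe_smul, map_smul, Complex.coe_smul]
  have hk : Continuous fun s => c s • u s := hcd.continuous.smul hud.continuous
  have hk1 : Continuous fun s => deriv c s • u s := hc'.smul hud.continuous
  have hks : HasCompactSupport fun s => c s • u s := hcs.smul_right
  have hk1s : HasCompactSupport fun s => deriv c s • u s := hcs.deriv.smul_right
  set y : ℝ → X := fun s => R (c s • u s) with hy
  -- Integration by parts transforms `y'` into $l$ times the transform of `y`. This cancels the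
  -- contribution of $l\,R(cu)$ and leaves the claim.
  set y' : ℝ → X := fun s => R (deriv c s • u s) + (l • R (c s • u s) - c s • u s) with hy'
  have hyd : ∀ s, HasDerivAt y (y' s) s := fun s => by
    have h1 := (hcd s).hasDerivAt.smul (hud s).hasDerivAt
    have h2 := (R.restrictScalars ℝ).hasFDerivAt.comp_hasDerivAt s h1
    convert! h2 using 1
    change _ = R (c s • deriv u s + deriv c s • u s)
    rw [hy', map_add, add_comm]
    -- The orbit law is assumed only from time $1$ on; before that the cutoff vanishes.
    rcases le_total s 1 with h | h
    · simp [hc0 s h]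
    · rw [hre, hre, resolvent_deriv_of_orbit T hR hud (fun h' hh' => hTu s h' h hh'), smul_sub,
        smul_comm]
      simp only [hre]
  have hy'c : Continuous y' := by fun_prop
  have hys : HasCompactSupport y := hks.comp_left (g := R) (map_zero R)
  have hRk1s : HasCompactSupport fun s => R (deriv c s • u s) := hk1s.comp_left (g := R) (map_zero R)
  have hy's : HasCompactSupport y' := hRk1s.add ((hys.smul_left (f := fun _ => l)).sub hks)
  have hyc : Continuous y := by fun_prop
  have hdl := laplace_deriv hyd hy'c hys hy's l
  have e : laplace y' l = R (laplace (fun s => deriv c s • u s) l) +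
      (l • laplace y l - laplace (fun s => c s • u s) l) := by
    rw [← laplace_map R hk1 hk1s]
    simp only [laplace, hy', smul_add, smul_sub]
    have i1 := integrable_exp_smul (by fun_prop) hRk1s l
    have i2 := (integrable_exp_smul hyc hys l).smul l
    have i3 := integrable_exp_smul hk hks l
    have i2' : Integrable fun s : ℝ => Complex.exp (-(l * s)) • l • R (c s • u s) := by
      refine i2.congr (Eventually.of_forall fun s => ?_)
      exact smul_comm _ _ _
    have i4 : Integrable fun s : ℝ => Complex.exp (-(l * s)) • l • R (c s • u s) -
        Complex.exp (-(l * s)) • c s • u s := i2'.sub i3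
    rw [integral_add i1 i4, integral_sub i2' i3, ← MeasureTheory.integral_smul]
    congr 2
    refine integral_congr_ae (Eventually.of_forall fun s => ?_)
    exact smul_comm _ _ _
  rw [hdl] at e
  have : R (laplace (fun s => deriv c s • u s) l) - laplace (fun s => c s • u s) l = 0 := by
    rw [← sub_eq_zero] at e
    rw [← neg_eq_zero, ← e]
    abel
  exact (sub_eq_zero.mp this).symm

end Identity

/-! ### The smooth ramp. -/

section Cutoff

open scoped ContDiff

/-- A smooth transition from `0` on `(-∞, 1]` to `1` on `[2, ∞)`. -/
noncomputable def ramp (s : ℝ) : ℝ := Real.smoothTransition (s - 1)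

theorem contDiff_ramp : ContDiff ℝ ∞ ramp :=
  Real.smoothTransition.contDiff.comp (contDiff_id.sub contDiff_const)

theorem ramp_of_le {s : ℝ} (hs : s ≤ 1) : ramp s = 0 :=
  Real.smoothTransition.zero_of_nonpos (by linarith)

theorem ramp_of_ge {s : ℝ} (hs : 2 ≤ s) : ramp s = 1 :=
  Real.smoothTransition.one_of_one_le (by linarith)

theorem contDiff_deriv_ramp : ContDiff ℝ ∞ (deriv ramp) :=
  ((contDiff_infty_iff_deriv).mp contDiff_ramp).2

theorem deriv_ramp_of_lt {s : ℝ} (hs : s < 1) : deriv ramp s = 0 := by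
  have : ramp =ᶠ[𝓝 s] fun _ => 0 := by
    filter_upwards [gt_mem_nhds hs] with r hr using ramp_of_le hr.le
  rw [this.deriv_eq, deriv_const]

theorem deriv_ramp_of_gt {s : ℝ} (hs : 2 < s) : deriv ramp s = 0 := by
  have : ramp =ᶠ[𝓝 s] fun _ => 1 := by
    filter_upwards [lt_mem_nhds hs] with r hr using ramp_of_ge hr.le
  rw [this.deriv_eq, deriv_const]

theorem hasCompactSupport_deriv_ramp : HasCompactSupport (deriv ramp) :=
  HasCompactSupport.intro (isCompact_Icc (a := 1) (b := 2)) fun s hs => by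
    rw [mem_Icc, not_and_or, not_le, not_le] at hs
    exact hs.elim deriv_ramp_of_lt deriv_ramp_of_gt

end Cutoff

end SemigroupGrowth

/-! ### The multiplier operator reproduces the damped orbit. -/

namespace SemigroupGrowth

open scoped ContDiff

variable {X : Type*} [NormedAddCommGroup X] [NormedSpace ℂ X] [CompleteSpace X]

theorem fourier_map {E F : Type*} [NormedAddCommGroup E] [NormedSpace ℂ E] [CompleteSpace E]
    [NormedAddCommGroup F] [NormedSpace ℂ F] [CompleteSpace F] (S : E →L[ℂ] F) {f : ℝ → E}
    (hf : Integrable f) (η : ℝ) : 𝓕 (fun s => S (f s)) η = S (𝓕 f η) := by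
  have hi : Integrable fun v : ℝ =>
      Complex.exp (((-2 * Real.pi * v * η : ℝ) : ℂ) * Complex.I) • f v := by
    refine hf.mono (AEStronglyMeasurable.smul (Continuous.aestronglyMeasurable (by fun_prop)) hf.1)
      (Eventually.of_forall fun v => ?_)
    rw [norm_smul, Complex.norm_exp_ofReal_mul_I, one_mul]
  rw [Real.fourier_real_eq_integral_exp_smul, Real.fourier_real_eq_integral_exp_smul,
    ← ContinuousLinearMap.integral_comp_comm _ hi]
  simp only [map_smul]

theorem fourierInv_add {E : Type*} [NormedAddCommGroup E] [NormedSpace ℂ E] {f g : ℝ → E}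
    (hf : Integrable f) (hg : Integrable g) (r : ℝ) :
    𝓕⁻ (fun η => f η + g η) r = 𝓕⁻ f r + 𝓕⁻ g r := by
  have hi : ∀ f : ℝ → E, Integrable f → Integrable fun η : ℝ =>
      Complex.exp (Complex.I * ((2 * Real.pi * η : ℝ) : ℂ) * r) • f η := fun f hf => by
    refine hf.mono (AEStronglyMeasurable.smul (Continuous.aestronglyMeasurable (by fun_prop)) hf.1)
      (Eventually.of_forall fun v => ?_)
    have : Complex.I * ((2 * Real.pi * v : ℝ) : ℂ) * r =
        ((2 * Real.pi * v * r : ℝ) : ℂ) * Complex.I := by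
      push_cast
      ring
    rw [norm_smul, this, Complex.norm_exp_ofReal_mul_I, one_mul]
  simp only [fourierInv_real_eq, smul_add]
  exact integral_add (hi f hf) (hi g hg)

/-- A smooth compactly supported function, multiplied by a decaying exponential, is a Schwartz
function. -/
theorem exists_schwartz_exp_smul {E : Type*} [NormedAddCommGroup E] [NormedSpace ℂ E] {k : ℝ → E}
    (hk : ContDiff ℝ ∞ k) (hc : HasCompactSupport k) (w : ℝ) :
    ∃ f : 𝓢(ℝ, E), ∀ s, f s = Complex.exp (-(w * s)) • k s := by
  have h1 : ContDiff ℝ ∞ fun s : ℝ => Complex.exp (-(w * s)) :=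
    ((contDiff_const.mul Complex.ofRealCLM.contDiff).neg).cexp
  have h2 : HasCompactSupport fun s : ℝ => Complex.exp (-(w * s)) • k s := hc.smul_left
  exact ⟨h2.toSchwartzMap (h1.smul hk), fun s => rfl⟩

omit [CompleteSpace X] in
theorem laplace_sub {k₁ k₂ : ℝ → X} (h₁ : Continuous k₁) (hc₁ : HasCompactSupport k₁)
    (h₂ : Continuous k₂) (hc₂ : HasCompactSupport k₂) (l : ℂ) :
    laplace (fun s => k₁ s - k₂ s) l = laplace k₁ l - laplace k₂ l := by
  simp only [laplace, smul_sub]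
  exact integral_sub (integrable_exp_smul h₁ hc₁ l) (integrable_exp_smul h₂ hc₂ l)

/-- The multiplier operator with symbol `R(w + i ξ, A)`, applied to a suitable function, gives a
part of a damped orbit. -/
theorem fourierMultiplier_ramp (T : C0Semigroup X)
    (hρ : ∀ l : ℂ, 0 < l.re → l ∈ opResolventSet T.generator)
    {g₀ : ℝ → ℝ} (hg₀_mono : MonotoneOn g₀ (Set.Ioi 0))
    (hg₀ : ∀ l : ℂ, 0 < l.re → ‖opResolvent T.generator l‖ ≤ g₀ (1 / l.re))
    {B : X →ₗ.[ℂ] X} [CompleteSpace (GraphDomain B)] {J : X →L[ℂ] GraphDomain B} {J₀ : X →L[ℂ] X}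
    (hJ : ∀ z, GraphDomain.toX B (J z) = J₀ z)
    (hJ₀ : ∀ l : ℂ, 0 < l.re → Commute J₀ (opResolvent T.generator l))
    {u : ℝ → X} (hu : ContDiff ℝ ∞ u)
    (hTu : ∀ s h : ℝ, 1 ≤ s → 0 ≤ h → u (h + s) = T.op h.toNNReal (u s))
    {w : ℝ} (hw : 0 < w) {f : 𝓢(ℝ, GraphDomain B)}
    (hf : ∀ s, f s = J (Complex.exp (-(w * s)) • deriv ramp s • u s)) {r : ℝ} (hr : 2 ≤ r) :
    fourierMultiplier (resolventSymbol T.generator B w) f r =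
      Complex.exp (-(w * r)) • J₀ (u r) := by
  set Rs := opResolvent T.generator with hRs
  have hre : ∀ η : ℝ, w ≤ ((w : ℂ) + Complex.I * ((2 * Real.pi * η : ℝ) : ℂ)).re := fun η => by
    simp
  -- The subtracted ramp switches the orbit off between $r+1$ and $r+2$: everything becomes
  -- compactly supported, and $c(r)=1$ is kept.
  set c : ℝ → ℝ := fun s => ramp s - ramp (s - r) with hc
  have hcd : ContDiff ℝ ∞ c := contDiff_ramp.sub (contDiff_ramp.comp (contDiff_id.sub contDiff_const))
  have hc0 : ∀ s ≤ 1, c s = 0 := fun s hs => by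
    simp only [hc]
    rw [ramp_of_le hs, ramp_of_le (by linarith), sub_zero]
  have hcs : HasCompactSupport c :=
    HasCompactSupport.intro (isCompact_Icc (a := 1) (b := r + 2)) fun s hs => by
      rw [mem_Icc, not_and_or, not_le, not_le] at hs
      rcases hs with h | h
      · exact hc0 s h.le
      · simp only [hc]
        rw [ramp_of_ge (by linarith), ramp_of_ge (by linarith), sub_self]
  have hcr : c r = 1 := by
    simp only [hc]
    rw [ramp_of_ge hr, ramp_of_le (by linarith), sub_zero]
  have hrd : Differentiable ℝ ramp := contDiff_ramp.differentiable (by simp)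
  have hc' : ∀ s, deriv c s = deriv ramp s - deriv ramp (s - r) := fun s =>
    ((hrd s).hasDerivAt.sub ((hrd (s - r)).hasDerivAt.comp_sub_const s r)).deriv
  set k₁ : ℝ → X := fun s => deriv ramp s • u s with hk₁
  set k₂ : ℝ → X := fun s => deriv ramp (s - r) • u s with hk₂
  set k₃ : ℝ → X := fun s => c s • u s with hk₃
  have hd₁ : ContDiff ℝ ∞ k₁ := contDiff_deriv_ramp.smul hu
  have hd₂ : ContDiff ℝ ∞ k₂ :=
    (contDiff_deriv_ramp.comp (contDiff_id.sub contDiff_const)).smul hu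
  have hd₃ : ContDiff ℝ ∞ k₃ := hcd.smul hu
  have hs₁ : HasCompactSupport k₁ := hasCompactSupport_deriv_ramp.smul_right
  have hs₂ : HasCompactSupport k₂ :=
    (hasCompactSupport_deriv_ramp.comp_homeomorph (Homeomorph.subRight r)).smul_right
  have hs₃ : HasCompactSupport k₃ := hcs.smul_right
  obtain ⟨f₁, hf₁⟩ := exists_schwartz_exp_smul hd₁ hs₁ w
  obtain ⟨f₂, hf₂⟩ := exists_schwartz_exp_smul hd₂ hs₂ w
  obtain ⟨f₃, hf₃⟩ := exists_schwartz_exp_smul hd₃ hs₃ w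
  have ef₁ : (f₁ : ℝ → X) = fun s : ℝ => Complex.exp (-(w * s)) • k₁ s := funext hf₁
  have ef₂ : (f₂ : ℝ → X) = fun s : ℝ => Complex.exp (-(w * s)) • k₂ s := funext hf₂
  have ef₃ : (f₃ : ℝ → X) = fun s : ℝ => Complex.exp (-(w * s)) • k₃ s := funext hf₃
  have hlap : ∀ η : ℝ, J₀ (𝓕 (f₃ : ℝ → X) η) =
      Rs (w + Complex.I * ((2 * Real.pi * η : ℝ) : ℂ)) (J₀ (𝓕 (f₁ : ℝ → X) η)) -
        Rs (w + Complex.I * ((2 * Real.pi * η : ℝ) : ℂ)) (J₀ (𝓕 (f₂ : ℝ → X) η)) := fun η => by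
    have hpos := hw.trans_le (hre η)
    have h1 := laplace_cutoff T (isResolventAt_of_re_pos T hρ hpos) hu hTu hcd hcs hc0
    have h2 : (fun s => deriv c s • u s) = fun s => k₁ s - k₂ s := by
      ext s
      rw [hc', sub_smul]
    rw [h2, laplace_sub hd₁.continuous hs₁ hd₂.continuous hs₂] at h1
    have h3 := congrArg (fun S : X →L[ℂ] X => S
      (laplace k₁ (w + Complex.I * ((2 * Real.pi * η : ℝ) : ℂ)) -
        laplace k₂ (w + Complex.I * ((2 * Real.pi * η : ℝ) : ℂ)))) (hJ₀ _ hpos).eq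
    simp only [mul_apply_eq_comp] at h3
    rw [ef₁, ef₂, ef₃, fourier_exp_smul, fourier_exp_smul, fourier_exp_smul, h1, h3, map_sub,
      map_sub]
  -- Since $c'=\psi'-\psi'(\cdot-r)$, the output splits into the cut-off damped orbit `f₃` and the
  -- response to `f₂`, which vanishes before $r+1$ and so contributes nothing at $r$.
  have hsymb : (fun η : ℝ => resolventSymbol T.generator B w (2 * Real.pi * η)
      (𝓕 (f : ℝ → GraphDomain B) η)) = fun η =>
      (Rs (w + Complex.I * ((2 * Real.pi * η : ℝ) : ℂ)) * J₀) (𝓕 (f₂ : ℝ → X) η) +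
        J₀ (𝓕 (f₃ : ℝ → X) η) := by
    ext η
    have ef : (f : ℝ → GraphDomain B) = fun s => J (f₁ s) := by
      ext1 s
      rw [hf, hf₁]
    rw [ef, fourier_map J f₁.integrable, hlap η, mul_apply_eq_comp, add_sub_cancel]
    change Rs _ (GraphDomain.toX B (J _)) = _
    rw [hJ]
  have hG : ∀ l : ℂ, w ≤ l.re → ‖Rs l * J₀‖ ≤ g₀ (1 / w) * ‖J₀‖ := fun l hl =>
    (norm_mul_le _ _).trans (mul_le_mul_of_nonneg_right
      (norm_opResolvent_le hg₀_mono hg₀ hw hl) (norm_nonneg _))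
  have hdiff : ∀ l : ℂ, 0 < l.re → DifferentiableAt ℂ (fun l => Rs l * J₀) l := fun l hl =>
    (hasDerivAt_opResolvent T hρ hg₀_mono hg₀ hl).differentiableAt.mul_const J₀
  have hint₂ : Integrable fun η : ℝ =>
      (Rs (w + Complex.I * ((2 * Real.pi * η : ℝ) : ℂ)) * J₀) (𝓕 (f₂ : ℝ → X) η) := by
    have hF : Integrable (𝓕 (f₂ : ℝ → X)) := (𝓕 f₂).integrable
    have hcont : Continuous fun η : ℝ =>
        (Rs (w + Complex.I * ((2 * Real.pi * η : ℝ) : ℂ)) * J₀) := by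
      have h1 := continuous_verticalLine (fun l hl => (hdiff l hl).continuousAt) hw
      have h2 := h1.comp (by fun_prop : Continuous fun η : ℝ => 2 * Real.pi * η)
      refine h2.congr fun η => ?_
      simp only [Function.comp_apply, mul_comm]
    have hFc : Continuous (𝓕 (f₂ : ℝ → X)) := (𝓕 f₂).continuous
    refine (hF.norm.const_mul (g₀ (1 / w) * ‖J₀‖)).mono' (hcont.clm_apply hFc).aestronglyMeasurable
      (Eventually.of_forall fun η => ?_)
    exact ContinuousLinearMap.le_of_opNorm_le _ (hG _ (hre η)) _
  have hint₃ : Integrable fun η : ℝ => J₀ (𝓕 (f₃ : ℝ → X) η) :=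
    J₀.integrable_comp (𝓕 f₃).integrable
  have hzero : 𝓕⁻ (fun η : ℝ =>
      (Rs (w + Complex.I * ((2 * Real.pi * η : ℝ) : ℂ)) * J₀) (𝓕 (f₂ : ℝ → X) η)) r = 0 := by
    rw [ef₂]
    refine fourierInv_symbol_eq_zero hdiff hw hG (hd₂.of_le (by norm_cast)) hs₂ (b := r)
      (fun s hs => ?_) le_rfl
    rw [hk₂]
    simp only
    rw [deriv_ramp_of_lt (by linarith), zero_smul]
  have hinv : 𝓕⁻ (fun η : ℝ => J₀ (𝓕 (f₃ : ℝ → X) η)) r = J₀ (f₃ r) := by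
    have h1 : (fun η : ℝ => J₀ (𝓕 (f₃ : ℝ → X) η)) =
        𝓕 ((f₃.postcompCLM J₀ : 𝓢(ℝ, X)) : ℝ → X) := by
      ext η
      exact (fourier_map J₀ f₃.integrable η).symm
    rw [h1, (f₃.postcompCLM J₀).continuous.fourierInv_fourier_eq (f₃.postcompCLM J₀).integrable
      (𝓕 (f₃.postcompCLM J₀)).integrable]
    rfl
  rw [fourierMultiplier, hsymb, fourierInv_add hint₂ hint₃, hzero, hinv, zero_add, hf₃, hk₃]
  simp only
  rw [hcr, one_smul, map_smul]

/-- The multiplier inequality is compared on two unit windows: the input sits on $[1,2]$, and the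
output is observed on $[t-1,t]$. The condition $3\le t$ keeps the second window in $[2,\infty)$,
where the output is the damped orbit. -/
theorem norm_smoothOrbit_le_of_mem_multiplierBounds (T : C0Semigroup X)
    (hρ : ∀ l : ℂ, 0 < l.re → l ∈ opResolventSet T.generator)
    {g₀ : ℝ → ℝ} (hg₀_mono : MonotoneOn g₀ (Set.Ioi 0))
    (hg₀ : ∀ l : ℂ, 0 < l.re → ‖opResolvent T.generator l‖ ≤ g₀ (1 / l.re))
    {B : X →ₗ.[ℂ] X} [CompleteSpace (GraphDomain B)] {J : X →L[ℂ] GraphDomain B} {J₀ : X →L[ℂ] X}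
    (hJ : ∀ z, GraphDomain.toX B (J z) = J₀ z) (hJn : ∀ z, ‖J z‖ = ‖J₀ z‖ + ‖z‖)
    (hJT : ∀ t z, J₀ (T.op t z) = T.op t (J₀ z))
    (hJR : ∀ l : ℂ, 0 < l.re → Commute J₀ (opResolvent T.generator l))
    {M D K t : ℝ} (hM : 0 < M) (hTM : ∀ t : ℝ≥0, (t : ℝ) ≤ 3 → ‖T.op t‖ ≤ M)
    (hD : ∀ s, ‖deriv ramp s‖ ≤ D) (ht : 3 ≤ t) {p q : ℝ≥0∞} (hp : 1 ≤ p) (hq : 1 ≤ q)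
    (hK : K ∈ multiplierBounds p q (resolventSymbol T.generator B (1 / t)))
    {φ : ContDiffBump (0 : ℝ)} (hφ : φ.rOut ≤ 1) (z : X) :
    ‖smoothOrbit T φ (J₀ z) t‖ ≤ K * D * M ^ 2 * Real.exp 1 * ‖J z‖ := by
  have hD0 : 0 ≤ D := (norm_nonneg _).trans (hD 0)
  have ht0 : 0 < t := by linarith
  set w : ℝ := 1 / t with hw
  have hw0 : 0 < w := by positivity
  set u := smoothOrbit T φ z with hu
  have hud : ContDiff ℝ ∞ u := contDiff_smoothOrbit T φ z
  have hTu : ∀ s h : ℝ, 1 ≤ s → 0 ≤ h → u (h + s) = T.op h.toNNReal (u s) := fun s h hs hh =>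
    smoothOrbit_add T φ hφ z hs hh
  have hJu : ∀ s, J₀ (u s) = smoothOrbit T φ (J₀ z) s := map_smoothOrbit T φ hJT z
  obtain ⟨f₁, hf₁⟩ := exists_schwartz_exp_smul (contDiff_deriv_ramp.smul hud)
    (hasCompactSupport_deriv_ramp.smul_right) w
  set f : 𝓢(ℝ, GraphDomain B) := f₁.postcompCLM J with hfdef
  have hf : ∀ s, f s = J (Complex.exp (-(w * s)) • deriv ramp s • u s) := fun s => by
    rw [hfdef, SchwartzMap.postcompCLM_apply, hf₁]
    rfl
  have hid := fun r (hr : 2 ≤ r) =>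
    fourierMultiplier_ramp T hρ hg₀_mono hg₀ hJ hJR hud hTu hw0 hf (r := r) hr
  have hfn : ∀ s, ‖f s‖ ≤ ‖(Icc (1 : ℝ) 2).indicator (fun _ => D * (M * ‖J z‖)) s‖ := by
    intro s
    by_cases hs : s ∈ Icc (1 : ℝ) 2
    · rw [indicator_of_mem hs, Real.norm_of_nonneg (by positivity), hf, map_smul, norm_smul,
        ← Complex.coe_smul, map_smul, norm_smul, Complex.norm_real, Complex.norm_exp, hJn, hJn,
        hJu]
      have h1 := norm_smoothOrbit_le T φ hφ z hTM hs.1 hs.2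
      have h2 := norm_smoothOrbit_le T φ hφ (J₀ z) hTM hs.1 hs.2
      have h3 : Real.exp (-((w : ℂ) * s)).re ≤ 1 := by
        rw [Real.exp_le_one_iff]
        have := hs.1
        simp only [Complex.neg_re, Complex.mul_re, Complex.ofReal_re, Complex.ofReal_im, mul_zero,
          sub_zero]
        nlinarith
      calc _ ≤ 1 * (D * (M * ‖J₀ z‖ + M * ‖z‖)) := by
            gcongr
            exact hD s
        _ = _ := by ring
    · have : deriv ramp s = 0 := by
        rw [mem_Icc, not_and_or, not_le, not_le] at hs
        exact hs.elim deriv_ramp_of_lt deriv_ramp_of_gt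
      rw [indicator_of_notMem hs, hf, this, zero_smul, smul_zero, map_zero, norm_zero, norm_zero]
  -- The factor $M$ pays for moving from $s$ to $t$, at most one unit of time, and $e$ pays for the
  -- damping, because $ws\le1$ when $w=1/t$ and $s\le t$.
  have hun : ∀ s, ‖(Icc (t - 1) t).indicator
      (fun _ => ‖J₀ (u t)‖ / (M * Real.exp 1)) s‖ ≤ ‖fourierMultiplier
        (resolventSymbol T.generator B w) f s‖ := by
    intro s
    by_cases hs : s ∈ Icc (t - 1) t
    · rw [indicator_of_mem hs, Real.norm_of_nonneg (by positivity), hid s (by linarith [hs.1]),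
        norm_smul, Complex.norm_exp, div_le_iff₀ (by positivity)]
      have h1 := hTu s (t - s) (by linarith [hs.1]) (by linarith [hs.2])
      rw [sub_add_cancel] at h1
      rw [h1, hJT]
      have h2 : ‖T.op (t - s).toNNReal (J₀ (u s))‖ ≤ M * ‖J₀ (u s)‖ :=
        (T.op _).le_of_opNorm_le (hTM _ (by
          rw [Real.coe_toNNReal _ (by linarith [hs.2])]
          linarith [hs.1])) _
      have h3 : 1 ≤ Real.exp (-((w : ℂ) * s)).re * Real.exp 1 := by
        rw [← Real.exp_add, Real.one_le_exp_iff]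
        have h4 : w * s ≤ 1 := by
          rw [hw, div_mul_eq_mul_div, one_mul, div_le_one ht0]
          exact hs.2
        simp only [Complex.neg_re, Complex.mul_re, Complex.ofReal_re, Complex.ofReal_im, mul_zero,
          sub_zero]
        linarith
      calc ‖T.op (t - s).toNNReal (J₀ (u s))‖ ≤ 1 * (M * ‖J₀ (u s)‖) := by rwa [one_mul]
        _ ≤ (Real.exp (-((w : ℂ) * s)).re * Real.exp 1) * (M * ‖J₀ (u s)‖) := by gcongr
        _ = _ := by ring
    · rw [indicator_of_notMem hs, norm_zero]
      exact norm_nonneg _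
  have hp0 : p ≠ 0 := (zero_lt_one.trans_le hp).ne'
  have hq0 : q ≠ 0 := (zero_lt_one.trans_le hq).ne'
  -- Both indicators belong to intervals of length one, so their norms equal the constants for all
  -- $p,q\ge1$, infinity included.
  have hchain := (eLpNorm_mono (p := q) (μ := volume) hun).trans ((hK.2 f).trans
    (mul_le_mul_right (eLpNorm_mono (p := p) (μ := volume) hfn) _))
  rw [eLpNorm_indicator_const' measurableSet_Icc (by simp) hq0,
    eLpNorm_indicator_const' measurableSet_Icc (by simp) hp0, Real.volume_Icc, Real.volume_Icc,
    sub_sub_cancel, show (2 : ℝ) - 1 = 1 by norm_num, ENNReal.ofReal_one, ENNReal.one_rpow,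
    ENNReal.one_rpow, mul_one, mul_one, Real.enorm_of_nonneg (by positivity),
    Real.enorm_of_nonneg (by positivity), ← ENNReal.ofReal_mul hK.1,
    ENNReal.ofReal_le_ofReal_iff (mul_nonneg hK.1 (by positivity)),
    div_le_iff₀ (by positivity)] at hchain
  rw [← hJu]
  exact hchain.trans (le_of_eq (by ring))

end SemigroupGrowth

/-! ### The growth estimate. -/

open SemigroupGrowth in
theorem theorem6p1 {X : Type*} [NormedAddCommGroup X] [NormedSpace ℂ X] [CompleteSpace X]
    (T : C0Semigroup X)
    (hρ : ∀ l : ℂ, 0 < l.re → l ∈ opResolventSet T.generator)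
    (g₀ : ℝ → ℝ) (hg₀_pos : ∀ s, 0 < s → 0 < g₀ s) (hg₀_mono : MonotoneOn g₀ (Set.Ioi 0))
    (hg₀ : ∀ l : ℂ, 0 < l.re → ‖opResolvent T.generator l‖ ≤ g₀ (1 / l.re))
    (α : ℝ) (hα : 0 ≤ α)
    (g : ℝ → ℝ) (hg_pos : ∀ s, 0 < s → 0 < g s) (hg_mono : MonotoneOn g (Set.Ioi 0))
    (p q : ℝ≥0∞) (hp : 1 ≤ p) (hq : 1 ≤ q)
    (hmem : ∀ w : ℝ, 0 < w → w ≤ 1 → IsFourierMultiplier p q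
      (resolventSymbol T.generator (fracPow (oneSub T.generator) α) w))
    (hnorm : ∀ w : ℝ, 0 < w → w ≤ 1 → multiplierNorm p q
      (resolventSymbol T.generator (fracPow (oneSub T.generator) α) w) ≤ g (1 / w)) :
    ∃ C : ℝ, 0 ≤ C ∧
      ∀ (x : GraphDomain (fracPow (oneSub T.generator) α)) (t : ℝ≥0), 1 ≤ t →
        ‖T.op t (GraphDomain.incl _ x)‖ ≤ C * g t * ‖x‖ := by
  obtain ⟨N, hN⟩ := exists_isSectorialFamily hρ hg₀_mono hg₀
  have hinj : ∀ z, negFracPow (oneSub T.generator) α z = 0 → z = 0 := fun z =>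
    negFracPow_eq_zero hN hρ hα
  have hcs := GraphDomain.completeSpace _ (fracPow_isClosed hinj)
  obtain ⟨J, hJ, hJn, hJs⟩ := exists_toDomain hinj
  set J₀ := negFracPow (oneSub T.generator) α with hJ₀
  have hJT : ∀ t z, J₀ (T.op t z) = T.op t (J₀ z) := fun t z => by
    refine negFracPow_comm hN hρ hα (fun s hs => ?_) z
    ext x
    exact T.op_resolvent (isResolventAt_of_re_pos T hρ (by rw [Complex.ofReal_re]; linarith)) t x
  have hJR : ∀ l : ℂ, 0 < l.re → Commute J₀ (opResolvent T.generator l) := fun l hl => by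
    ext x
    refine negFracPow_comm hN hρ hα (fun s hs => ?_) x
    exact commute_opResolvent T hρ hl (by rw [Complex.ofReal_re]; linarith)
  obtain ⟨M, hM, hTM⟩ := T.exists_bound 3
  obtain ⟨D, hD⟩ := contDiff_deriv_ramp.continuous.bounded_above_of_compact_support
    hasCompactSupport_deriv_ramp
  have hD0 : 0 ≤ D := (norm_nonneg _).trans (hD 0)
  have hg1 := hg_pos 1 one_pos
  -- The first entry serves $1\le t\le3$, where $g(1)\le g(t)$; the second serves $t\ge3$.
  refine ⟨max (M / g 1) (2 * D * M ^ 2 * Real.exp 1), le_max_of_le_left (by positivity),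
    fun x t ht => ?_⟩
  have ht1 : (1 : ℝ) ≤ t := by exact_mod_cast ht
  have ht0 : (0 : ℝ) < t := by linarith
  have hgt := hg_pos t ht0
  have hxn : ‖GraphDomain.incl _ x‖ ≤ ‖x‖ := by
    rw [GraphDomain.norm_def]
    exact le_add_of_nonneg_right (norm_nonneg _)
  rcases le_total (t : ℝ) 3 with ht3 | ht3
  · have hgg : g 1 ≤ g t := hg_mono (mem_Ioi.mpr one_pos) (mem_Ioi.mpr ht0) ht1
    calc ‖T.op t (GraphDomain.incl _ x)‖ ≤ M * ‖x‖ :=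
          ((T.op t).le_of_opNorm_le (hTM t ht3) _).trans (by gcongr)
      _ = M / g 1 * g 1 * ‖x‖ := by rw [div_mul_cancel₀ _ hg1.ne']
      _ ≤ _ := by
          gcongr
          exact le_max_left _ _
  obtain ⟨z, rfl⟩ := hJs x
  have hincl : GraphDomain.incl _ (J z) = J₀ z := hJ z
  rw [hincl]
  set w : ℝ := 1 / t with hw
  have hw0 : 0 < w := by positivity
  have hw1 : w ≤ 1 := by rw [hw, div_le_one ht0]; exact ht1
  -- The multiplier norm is an infimum. The factor $2$, with $g>0$, gives room to pick an actual
  -- bound below $2g(1/w)=2g(t)$.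
  obtain ⟨K, hKm, hK⟩ := exists_lt_of_csInf_lt (hmem w hw0 hw1).2
    (lt_of_le_of_lt (hnorm w hw0 hw1) (lt_two_mul_self (hg_pos (1 / w) (by positivity))))
  have hwt : 1 / w = t := by rw [hw, one_div_one_div]
  rw [hwt] at hK
  have key : ‖T.orbit (J₀ z) t‖ ≤ K * D * M ^ 2 * Real.exp 1 * ‖J z‖ :=
    norm_le_of_norm_smoothOrbit_le T (J₀ z) t fun φ hφ =>
      norm_smoothOrbit_le_of_mem_multiplierBounds T hρ hg₀_mono hg₀ hJ hJn hJT hJR hM hTM hD ht3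
        hp hq hKm hφ z
  rw [C0Semigroup.orbit, Real.toNNReal_coe] at key
  calc _ ≤ K * D * M ^ 2 * Real.exp 1 * ‖J z‖ := key
    _ ≤ 2 * g t * D * M ^ 2 * Real.exp 1 * ‖J z‖ := by gcongr
    _ = 2 * D * M ^ 2 * Real.exp 1 * g t * ‖J z‖ := by ring
    _ ≤ _ := by
        gcongr
        exact le_max_right _ _
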